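/- Consider the KdV equation $u_t+6uu_x+u_{xxx}=0$ for real functions $u$ of $(x,t)$; a solution on an open set $\Omega\subseteq\mathbb R^2$ is a $C^3$ function $u$ on $\Omega$ satisfying the equation there. A smooth map $\Phi$ from an open set $D\subseteq\mathbb R^3$ of $(x,t,u)$-space to $\mathbb R^3$ with everywhere invertible derivative (a point transformation) is called a symmetry of KdV on $D$ if it transforms solutions into solutions: whenever $u$ is a solution on an open set $\Omega$ with graph in $D$, and $\Phi$ maps the graph of $u$ onto the graph of a $C^3$ function $v$ on an open set $\Omega'$, then $v$ is a solution on $\Omega'$. A vector field on an open set $M\subseteq\mathbb R^3$ is called an infinitesimal symmetry if it is the infinitesimal generator of a smooth local one-parameter group of transformations of $M$, each element of which is a symmetry on its domain. The KdV equation has precisely four symmetries, namely translation in space, translation in time, the Galilean boost and coupled scaling, in the following sense. (1) Let $u:\mathbb R^2\to\mathbb R$, let $a,b,c\in\mathbb R$ and $s\in\mathbb R\setminus\{0\}$. Then $u$ is a solution on $\mathbb R^2$ if and only if $u(x+a,t)$ is, if and only if $u(x,t+b)$ is, if and only if $\frac1{s^2}u\left(\frac xs,\frac t{s^3}\right)$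 is, if and only if $u(x+ct,t)-\frac c6$ is. (2) Let $D\subseteq\mathbb R^3$ be open, connected and non-empty. A point transformation $\Phi$ on $D$ is a symmetry of KdV if and only if it is a composition of the four transformations $$(x,t,u)\mapsto(x+a,t,u),\quad (x,t,u)\mapsto(x,t+b,u),\quad (x,t,u)\mapsto\left(x-ct,t,u-\tfrac c6\right),\quad (x,t,u)\mapsto\left(sx,s^3t,\tfrac{u}{s^2}\right),$$ that is, if and only if there are $a,b,c,s\in\mathbb R$ with $s\ne0$ and $\Phi(x,t,u)=\left(sx-cs^3t+a,\;s^3t+b,\;\frac{u}{s^2}-\frac c6\right)$ on $D$; and then $(a,b,c,s)$ is unique. (3) Let $M\subseteq\mathbb R^3$ be open, connected and non-empty. A vector field on $M$ is an infinitesimal symmetry of KdV if and only if it is a real linear combination of the infinitesimal generators of the four one-parameter groups above (with $s=e^{\varepsilon}$ for the scaling), namely $$\partial_x,\qquad \partial_t,\qquad -t\,\partial_x-\tfrac16\,\partial_u,\qquad x\,\partial_x+3t\,\partial_t-2u\,\partial_u;$$ and then the four coefficients are unique. -/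

import Mathlib

open scoped ContDiff

namespace KdV

/-- The base plane with coordinates `(x, t)`. -/
abbrev Base : Type := ℝ × ℝ

/-- The space of independent and dependent variables, with coordinates `((x, t), u)`. -/
abbrev Total : Type := Base × ℝ

/-- The left-hand side `u_t + 6 u u_x + u_xxx` of the KdV equation at the point `p = (x, t)`. -/
noncomputable def kdvExpr (u : Base → ℝ) (p : Base) : ℝ :=
  deriv (fun t : ℝ => u (p.1, t)) p.2
    + 6 * u p * deriv (fun x : ℝ => u (x, p.2)) p.1
    + iteratedDeriv 3 (fun x : ℝ => u (x, p.2)) p.1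

/-- `u` is a (classical, `C^3`) solution of the KdV equation on the set `Ω`
(used for open sets `Ω` only). -/
def IsSolutionOn (Ω : Set Base) (u : Base → ℝ) : Prop :=
  ContDiffOn ℝ 3 u Ω ∧ ∀ p ∈ Ω, kdvExpr u p = 0

/-- `u` is a `C^3` solution of the KdV equation on the whole plane. -/
def IsSolution (u : Base → ℝ) : Prop := IsSolutionOn Set.univ u

/-- The transformation `Φ`, considered on the domain `D` in `(x, t, u)`-space, transforms solutions
into solutions: if `u` is a solution on an open set `Ω` whose graph lies in `D`, and if `Φ` maps
the graph of `u` onto the graph of a `C^3` function `v` on an open set `Ω'`,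
then `v` is a solution. -/
def IsSymmetryOn (D : Set Total) (Φ : Total → Total) : Prop :=
  ∀ (Ω Ω' : Set Base) (u v : Base → ℝ), IsOpen Ω → IsOpen Ω' →
    IsSolutionOn Ω u → Ω.graphOn u ⊆ D →
    ContDiffOn ℝ 3 v Ω' → Φ '' Ω.graphOn u = Ω'.graphOn v →
    IsSolutionOn Ω' v

/-- `Φ` is a point transformation on `D`: smooth with everywhere invertible derivative. -/
def IsPointTransformationOn (D : Set Total) (Φ : Total → Total) : Prop :=
  ContDiffOn ℝ ∞ Φ D ∧ ∀ z ∈ D, (fderiv ℝ Φ z).IsInvertible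

/-- Translation in space, `(x, t, u) ↦ (x + a, t, u)`. -/
def spaceTranslation (a : ℝ) (z : Total) : Total := ((z.1.1 + a, z.1.2), z.2)

/-- Translation in time, `(x, t, u) ↦ (x, t + b, u)`. -/
def timeTranslation (b : ℝ) (z : Total) : Total := ((z.1.1, z.1.2 + b), z.2)

/-- The Galilean boost, `(x, t, u) ↦ (x - c t, t, u - c / 6)`. -/
noncomputable def galileanBoost (c : ℝ) (z : Total) : Total :=
  ((z.1.1 - c * z.1.2, z.1.2), z.2 - c / 6)

/-- Coupled scaling, `(x, t, u) ↦ (s x, s ^ 3 t, u / s ^ 2)`; used for `s ≠ 0` only. -/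
noncomputable def coupledScaling (s : ℝ) (z : Total) : Total :=
  ((s * z.1.1, s ^ 3 * z.1.2), z.2 / s ^ 2)

/-- A local one-parameter group of transformations of `M`: the map `Ψ` is defined on the open set
`W` of pairs `(ε, z)` containing all `(0, z)` with `z ∈ M`, takes values in `M`, is smooth, and
satisfies the group laws wherever they make sense. -/
structure IsLocalOneParameterGroup (M : Set Total) (W : Set (ℝ × Total))
    (Ψ : ℝ × Total → Total) : Prop where
  isOpen : IsOpen W
  mem_base : ∀ w ∈ W, w.2 ∈ M
  zero_mem : ∀ z ∈ M, ((0 : ℝ), z) ∈ W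
  mapsTo : Set.MapsTo Ψ W M
  smooth : ContDiffOn ℝ ∞ Ψ W
  zero_apply : ∀ z ∈ M, Ψ (0, z) = z
  comp_apply : ∀ (ε δ : ℝ) (z : Total), (δ, z) ∈ W → (ε, Ψ (δ, z)) ∈ W → (ε + δ, z) ∈ W →
    Ψ (ε, Ψ (δ, z)) = Ψ (ε + δ, z)
  inv_mem : ∀ (ε : ℝ) (z : Total), (ε, z) ∈ W → (-ε, Ψ (ε, z)) ∈ W
  inv_apply : ∀ (ε : ℝ) (z : Total), (ε, z) ∈ W → Ψ (-ε, Ψ (ε, z)) = z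

/-- The vector field `V` on `M` is an infinitesimal symmetry of the KdV equation: it is the
infinitesimal generator of a local one-parameter group of transformations of `M`
all of whose elements transform solutions into solutions. -/
def IsInfinitesimalSymmetryOn (M : Set Total) (V : Total → Total) : Prop :=
  ∃ (W : Set (ℝ × Total)) (Ψ : ℝ × Total → Total),
    IsLocalOneParameterGroup M W Ψ ∧
    (∀ ε : ℝ, IsSymmetryOn {z | (ε, z) ∈ W} (fun z => Ψ (ε, z))) ∧
    ∀ z ∈ M, HasDerivAt (fun ε : ℝ => Ψ (ε, z)) (V z) 0

/-- The infinitesimal generator at `z` of a family `Ψ ε` with `Ψ 0 = id`. -/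
noncomputable def generator (Ψ : ℝ → Total → Total) (z : Total) : Total :=
  deriv (fun ε : ℝ => Ψ ε z) 0

end KdV

/-! The affine maps of the normal form preserve KdV by direct substitution, so the substance lies in
the converse. Let `(x, t, u) ↦ (X, T, U)` be a symmetry. The test solutions are the stationary ones
`u = f x` with `f''' = -6 f f'`. Through any point of `D` they realise every pair `p = f'`, `q =
f''` (`exists_isWaveOn`). The derivation `lam θ`, with `θ` the new time along the graph, kills `θ`
and hence equals `J ∂_X` in the new coordinates, `J = lam θ ξ`. Multiplied by a power of `J`, the
KdV equation of the image therefore becomes an identity polynomial in `p` and `q`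
(`pullback_identity`, `jet_identity`).

Time-dependent test solutions come for free: precomposition with a Galilean boost gives another
symmetry (`boost`), whose first derivatives have `∂_t` replaced by `∂_t - c ∂_x`. First-order
identities thus become polynomial in `c` as well.

Comparing coefficients yields in turn: `X` and `T` do not involve `u` (`projectable`); `U_uu = 0`;
`T_x = 0`; `U_u X_x^2 = 1`; `X_xx = U_xu = 0`; `T_t = X_x^3`; `6 U X_x^3 = X_t + 6 u X_x`.
Differentiating these relations gives `U_x = U_t = 0` and makes `X_x` and `X_t` constant. The map is
then affine on a connected domain, and the last relation ties the shear of `X` to the constant term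
of `U`.

For the infinitesimal statement, each linear combination of generators is integrated explicitly.
Conversely, the finite classification on a small ball gives each element of the local group four
parameters. These are differentiable at `ε = 0`, and their derivatives are the coefficients of the
field; connectedness makes the coefficients global. -/

namespace KdV

open Set Filter Topology

/-! ### Directional derivatives and a coordinate form of the KdV expression. -/

section DirectionalDerivative

variable {E : Type*} [NormedAddCommGroup E] [NormedSpace ℝ E]

/-- The derivative of `g` in the direction `e`. -/
noncomputable def pd (e : E) (g : E → ℝ) (z : E) : ℝ := fderiv ℝ g z e

theorem pd_congr {D : Set E} (hD : IsOpen D) {g h : E → ℝ} (H : EqOn g h D) (e : E) :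
    EqOn (pd e g) (pd e h) D := fun z hz => by
  have : g =ᶠ[𝓝 z] h := H.eventuallyEq_of_mem (hD.mem_nhds hz)
  simp only [pd, this.fderiv_eq]

theorem pd_contDiffOn {D : Set E} (hD : IsOpen D) {g : E → ℝ} {m n : WithTop ℕ∞}
    (hg : ContDiffOn ℝ n g D) (hmn : m + 1 ≤ n) (e : E) : ContDiffOn ℝ m (pd e g) D :=
  (hg.fderiv_of_isOpen hD hmn).clm_apply contDiffOn_const

theorem pd_smooth {D : Set E} (hD : IsOpen D) {g : E → ℝ}
    (hg : ContDiffOn ℝ ∞ g D) (e : E) : ContDiffOn ℝ ∞ (pd e g) D :=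
  pd_contDiffOn hD hg (by simp) e

theorem pd_add {e : E} {g h : E → ℝ} {z : E} (hg : DifferentiableAt ℝ g z)
    (hh : DifferentiableAt ℝ h z) : pd e (fun y => g y + h y) z = pd e g z + pd e h z := by
  simp [pd, fderiv_fun_add hg hh]

theorem pd_sub {e : E} {g h : E → ℝ} {z : E} (hg : DifferentiableAt ℝ g z)
    (hh : DifferentiableAt ℝ h z) : pd e (fun y => g y - h y) z = pd e g z - pd e h z := by
  simp [pd, fderiv_fun_sub hg hh]

theorem pd_mul {e : E} {g h : E → ℝ} {z : E} (hg : DifferentiableAt ℝ g z)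
    (hh : DifferentiableAt ℝ h z) :
    pd e (fun y => g y * h y) z = g z * pd e h z + pd e g z * h z := by
  simp [pd, fderiv_fun_mul hg hh, mul_comm]

theorem pd_const {e : E} {k : ℝ} {z : E} : pd e (fun _ => k) z = 0 := by
  simp [pd]

theorem pd_comm {D : Set E} (hD : IsOpen D) {g : E → ℝ} (hg : ContDiffOn ℝ ∞ g D) (e e' : E)
    {z : E} (hz : z ∈ D) : pd e (pd e' g) z = pd e' (pd e g) z := by
  have hc : ContDiffAt ℝ ∞ g z := hg.contDiffAt (hD.mem_nhds hz)
  have hs : IsSymmSndFDerivAt ℝ g z := hc.isSymmSndFDerivAt (by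
    simpa using (WithTop.coe_le_coe.2 le_top : (((2 : ℕ∞) : WithTop ℕ∞)) ≤ ∞))
  have hd : DifferentiableAt ℝ (fderiv ℝ g) z :=
    ((hg.fderiv_of_isOpen hD (m := ∞) (by simp)).contDiffAt (hD.mem_nhds hz)).differentiableAt
      (by simp)
  have key : ∀ a b : E, pd a (pd b g) z = fderiv ℝ (fderiv ℝ g) z a b := fun a b => by
    have := fderiv_clm_apply hd (differentiableAt_const b)
    change fderiv ℝ (fun y => fderiv ℝ g y b) z a = _
    rw [this]
    simp
  rw [key, key, hs.eq]

theorem pd_comp_line {g : E → ℝ} {γ : ℝ → E} {e : E} {s : ℝ}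
    (hg : DifferentiableAt ℝ g (γ s)) (hγ : HasDerivAt γ e s) :
    HasDerivAt (fun r => g (γ r)) (pd e g (γ s)) s :=
  hg.hasFDerivAt.comp_hasDerivAt s hγ

end DirectionalDerivative

theorem hasDerivAt_slice_fst {u : Base → ℝ} {p : Base} (h : DifferentiableAt ℝ u p) :
    HasDerivAt (fun x => u (x, p.2)) (pd (1, 0) u p) p.1 :=
  pd_comp_line (γ := fun x => (x, p.2)) h ((hasDerivAt_id p.1).prodMk (hasDerivAt_const _ _))

theorem hasDerivAt_slice_snd {u : Base → ℝ} {p : Base} (h : DifferentiableAt ℝ u p) :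
    HasDerivAt (fun t => u (p.1, t)) (pd (0, 1) u p) p.2 :=
  pd_comp_line (γ := fun t => (p.1, t)) h ((hasDerivAt_const _ _).prodMk (hasDerivAt_id p.2))

theorem deriv_slice_eventuallyEq {Ω : Set Base} (hΩ : IsOpen Ω) {u : Base → ℝ} {g : ℝ → ℝ}
    {p : Base} (hp : p ∈ Ω) (hu : DifferentiableOn ℝ u Ω)
    (hg : g =ᶠ[𝓝 p.1] fun x => u (x, p.2)) :
    deriv g =ᶠ[𝓝 p.1] fun x => pd (1, 0) u (x, p.2) := by
  have hc : ∀ᶠ x in 𝓝 p.1, (x, p.2) ∈ Ω :=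
    (show Continuous fun x : ℝ => (x, p.2) by fun_prop).continuousAt.eventually
      (hΩ.mem_nhds (by simpa using hp))
  filter_upwards [hg.eventuallyEq_nhds, hc] with x hx hxΩ
  rw [hx.deriv_eq]
  exact (hasDerivAt_slice_fst (p := (x, p.2)) ((hu _ hxΩ).differentiableAt
    (hΩ.mem_nhds hxΩ))).deriv

theorem kdvExpr_eq {Ω : Set Base} (hΩ : IsOpen Ω) {u : Base → ℝ} (hu : ContDiffOn ℝ 3 u Ω)
    {p : Base} (hp : p ∈ Ω) :
    kdvExpr u p = pd (0, 1) u p + 6 * u p * pd (1, 0) u p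
      + pd (1, 0) (pd (1, 0) (pd (1, 0) u)) p := by
  have h1 : ContDiffOn ℝ 2 (pd (1, 0) u) Ω := pd_contDiffOn hΩ hu (by norm_num) _
  have h2 : ContDiffOn ℝ 1 (pd (1, 0) (pd (1, 0) u)) Ω := pd_contDiffOn hΩ h1 (by norm_num) _
  have e1 := deriv_slice_eventuallyEq hΩ hp (hu.differentiableOn (by simp)) .rfl
  have e2 := deriv_slice_eventuallyEq hΩ hp (h1.differentiableOn (by simp)) e1
  have e3 := deriv_slice_eventuallyEq hΩ hp (h2.differentiableOn (by simp)) e2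
  have ht := hasDerivAt_slice_snd ((hu.differentiableOn (by simp)).differentiableAt
    (hΩ.mem_nhds hp))
  rw [kdvExpr, ht.deriv, e1.eq_of_nhds, iteratedDeriv_succ, iteratedDeriv_succ, iteratedDeriv_one,
    e3.eq_of_nhds]

theorem IsSolutionOn.congr {Ω : Set Base} (hΩ : IsOpen Ω) {u v : Base → ℝ}
    (hu : IsSolutionOn Ω u) (huv : EqOn v u Ω) : IsSolutionOn Ω v := by
  have hv : ContDiffOn ℝ 3 v Ω := hu.1.congr huv
  refine ⟨hv, fun p hp => ?_⟩
  rw [← hu.2 p hp, kdvExpr_eq hΩ hv hp, kdvExpr_eq hΩ hu.1 hp, huv hp, pd_congr hΩ huv _ hp,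
    pd_congr hΩ huv _ hp,
    pd_congr hΩ (pd_congr hΩ (pd_congr hΩ huv _) _) _ hp]

/-! ### The four transformations preserve solutions. -/

/-- The affine change of independent variables belonging to a KdV symmetry. -/
def baseMap (l c a b : ℝ) (p : Base) : Base := (l * (p.1 + c * p.2 + a), l ^ 3 * (p.2 + b))

theorem baseMap_hasFDerivAt (l c a b : ℝ) (p : Base) :
    HasFDerivAt (baseMap l c a b)
      ((l • (ContinuousLinearMap.fst ℝ ℝ ℝ + c • ContinuousLinearMap.snd ℝ ℝ ℝ)).prod
        (l ^ 3 • ContinuousLinearMap.snd ℝ ℝ ℝ)) p := by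
  have h1 : HasFDerivAt (fun p : Base => p.1) (ContinuousLinearMap.fst ℝ ℝ ℝ) p := hasFDerivAt_fst
  have h2 : HasFDerivAt (fun p : Base => p.2) (ContinuousLinearMap.snd ℝ ℝ ℝ) p := hasFDerivAt_snd
  exact (((h1.add (h2.const_mul c)).add_const a).const_mul l).prodMk
    ((h2.add_const b).const_mul (l ^ 3))

theorem baseMap_contDiff (l c a b : ℝ) {n : WithTop ℕ∞} : ContDiff ℝ n (baseMap l c a b) := by
  unfold baseMap
  fun_prop

theorem pd_fst_comp_baseMap {l c a b k d : ℝ} {w : Base → ℝ} {p : Base}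
    (hw : DifferentiableAt ℝ w (baseMap l c a b p)) :
    pd (1, 0) (fun p => k * w (baseMap l c a b p) - d) p
      = k * l * pd (1, 0) w (baseMap l c a b p) := by
  have h := ((hw.hasFDerivAt.comp p (baseMap_hasFDerivAt l c a b p)).const_mul k).sub_const d
  have h' : fderiv ℝ (fun p => k * w (baseMap l c a b p) - d) p = _ := h.fderiv
  have e : ((l : ℝ), (0 : ℝ)) = l • ((1 : ℝ), (0 : ℝ)) := by simp
  have e' : (ContinuousLinearMap.prod (l • (ContinuousLinearMap.fst ℝ ℝ ℝ
      + c • ContinuousLinearMap.snd ℝ ℝ ℝ)) (l ^ 3 • ContinuousLinearMap.snd ℝ ℝ ℝ))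
      ((1 : ℝ), (0 : ℝ)) = (l, 0) := by simp
  simp only [pd, h', _root_.smul_apply, ContinuousLinearMap.comp_apply]
  rw [e', e, map_smul, smul_eq_mul, smul_eq_mul, mul_assoc]

theorem pd_snd_comp_baseMap {l c a b k d : ℝ} {w : Base → ℝ} {p : Base}
    (hw : DifferentiableAt ℝ w (baseMap l c a b p)) :
    pd (0, 1) (fun p => k * w (baseMap l c a b p) - d) p
      = k * (l * c * pd (1, 0) w (baseMap l c a b p)
        + l ^ 3 * pd (0, 1) w (baseMap l c a b p)) := by
  have h := ((hw.hasFDerivAt.comp p (baseMap_hasFDerivAt l c a b p)).const_mul k).sub_const d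
  have h' : fderiv ℝ (fun p => k * w (baseMap l c a b p) - d) p = _ := h.fderiv
  have e : ((l * c : ℝ), (l ^ 3 : ℝ))
      = (l * c) • ((1 : ℝ), (0 : ℝ)) + l ^ 3 • ((0 : ℝ), (1 : ℝ)) := by simp
  have e' : (ContinuousLinearMap.prod (l • (ContinuousLinearMap.fst ℝ ℝ ℝ
      + c • ContinuousLinearMap.snd ℝ ℝ ℝ)) (l ^ 3 • ContinuousLinearMap.snd ℝ ℝ ℝ))
      ((0 : ℝ), (1 : ℝ)) = (l * c, l ^ 3) := by simp
  simp only [pd, h', _root_.smul_apply, ContinuousLinearMap.comp_apply]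
  rw [e', e, map_add, map_smul, map_smul, smul_eq_mul, smul_eq_mul, smul_eq_mul]

/-- The combined action of scaling, boost and translations on functions of `(x, t)` preserves
solutions. -/
theorem IsSolutionOn.transform {Ω : Set Base} (hΩ : IsOpen Ω) {u : Base → ℝ}
    (hu : IsSolutionOn Ω u) (l c a b : ℝ) :
    IsSolutionOn (baseMap l c a b ⁻¹' Ω) (fun p => l ^ 2 * u (baseMap l c a b p) - c / 6) := by
  set α := baseMap l c a b with hα
  have hαc : Continuous α := (baseMap_contDiff l c a b (n := 0)).continuous
  have hΩ' : IsOpen (α ⁻¹' Ω) := hΩ.preimage hαc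
  have hv : ContDiffOn ℝ 3 (fun p => l ^ 2 * u (α p) - c / 6) (α ⁻¹' Ω) :=
    (contDiffOn_const.mul (hu.1.comp (baseMap_contDiff l c a b).contDiffOn
      (fun _ h => h))).sub contDiffOn_const
  have diff : ∀ {w : Base → ℝ}, DifferentiableOn ℝ w Ω → ∀ p ∈ α ⁻¹' Ω,
      DifferentiableAt ℝ w (α p) := fun hw p hp => hw.differentiableAt (hΩ.mem_nhds hp)
  have h1 : ContDiffOn ℝ 2 (pd (1, 0) u) Ω := pd_contDiffOn hΩ hu.1 (by norm_num) _
  have h2 : ContDiffOn ℝ 1 (pd (1, 0) (pd (1, 0) u)) Ω := pd_contDiffOn hΩ h1 (by norm_num) _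
  have d0 := diff (hu.1.differentiableOn (by simp))
  have e1 : EqOn (pd (1, 0) (fun p => l ^ 2 * u (α p) - c / 6))
      (fun p => l ^ 2 * l * pd (1, 0) u (α p) - 0) (α ⁻¹' Ω) := fun p hp => by
    rw [pd_fst_comp_baseMap (d0 p hp)]; simp [hα]
  have e2 : EqOn (pd (1, 0) (pd (1, 0) (fun p => l ^ 2 * u (α p) - c / 6)))
      (fun p => l ^ 2 * l * l * pd (1, 0) (pd (1, 0) u) (α p) - 0) (α ⁻¹' Ω) := fun p hp => by
    rw [pd_congr hΩ' e1 _ hp,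
      pd_fst_comp_baseMap (diff (h1.differentiableOn (by simp)) p hp)]; simp [hα]
  refine ⟨hv, fun p hp => ?_⟩
  have hk := hu.2 _ hp
  rw [kdvExpr_eq hΩ hu.1 hp] at hk
  rw [kdvExpr_eq hΩ' hv hp, e1 hp, pd_congr hΩ' e2 _ hp, pd_snd_comp_baseMap (d0 p hp),
    pd_fst_comp_baseMap (diff (h2.differentiableOn (by simp)) p hp)]
  -- The `c u_x` produced by the time derivative cancels against the shift `-c / 6` in `6 v v_x`.
  -- Every remaining term scales by `l ^ 5`.
  linear_combination l ^ 5 * hk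

theorem IsSolution.transform {u : Base → ℝ} (hu : IsSolution u) (l c a b : ℝ) :
    IsSolution (fun p => l ^ 2 * u (baseMap l c a b p) - c / 6) := by
  simpa [IsSolution] using IsSolutionOn.transform isOpen_univ hu l c a b

theorem isSolution_translate_space_iff (u : Base → ℝ) (a : ℝ) :
    IsSolution u ↔ IsSolution (fun p => u (p.1 + a, p.2)) := by
  refine ⟨fun h => ?_, fun h => ?_⟩
  · simpa [baseMap] using h.transform 1 0 a 0
  · simpa [baseMap] using h.transform 1 0 (-a) 0

theorem isSolution_translate_time_iff (u : Base → ℝ) (b : ℝ) :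
    IsSolution u ↔ IsSolution (fun p => u (p.1, p.2 + b)) := by
  refine ⟨fun h => ?_, fun h => ?_⟩
  · simpa [baseMap] using h.transform 1 0 0 b
  · simpa [baseMap] using h.transform 1 0 0 (-b)

theorem isSolution_scale_iff (u : Base → ℝ) {s : ℝ} (hs : s ≠ 0) :
    IsSolution u ↔ IsSolution (fun p => 1 / s ^ 2 * u (1 / s * p.1, 1 / s ^ 3 * p.2)) := by
  refine ⟨fun h => ?_, fun h => ?_⟩
  · simpa [baseMap] using h.transform (1 / s) 0 0 0
  · have := h.transform s 0 0 0
    simpa [baseMap, hs] using this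

theorem isSolution_boost_iff (u : Base → ℝ) (c : ℝ) :
    IsSolution u ↔ IsSolution (fun p => u (p.1 + c * p.2, p.2) - c / 6) := by
  refine ⟨fun h => ?_, fun h => ?_⟩
  · simpa [baseMap] using h.transform 1 c 0 0
  · have := h.transform 1 (-c) 0 0
    simpa [baseMap, neg_div] using this

/-- The composition of the four KdV symmetries with parameters `a`, `b`, `c`, `s`. -/
noncomputable def normalForm (a b c s : ℝ) (z : Total) : Total :=
  ((s * z.1.1 - c * (s ^ 3 * z.1.2) + a, s ^ 3 * z.1.2 + b), z.2 / s ^ 2 - c / 6)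

theorem comp_eq_normalForm (a b c s : ℝ) :
    spaceTranslation a ∘ timeTranslation b ∘ galileanBoost c ∘ coupledScaling s
      = normalForm a b c s := rfl

/-- Solving the normal form for the old variables exhibits `v` as the transform of `u` with
parameters `1 / s`, `c`, `-a - c * b`, `-b`, so `IsSolutionOn.transform` applies. -/
theorem isSymmetryOn_of_eqOn_normalForm {D : Set Total} {Φ : Total → Total} {a b c s : ℝ}
    (hs : s ≠ 0) (h : EqOn Φ (normalForm a b c s) D) : IsSymmetryOn D Φ := by
  intro Ω Ω' u v hΩ hΩ' hu hD hv himg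
  have key : ∀ p' ∈ Ω', baseMap (1 / s) c (-a - c * b) (-b) p' ∈ Ω ∧
      v p' = (1 / s) ^ 2 * u (baseMap (1 / s) c (-a - c * b) (-b) p') - c / 6 := by
    intro p' hp'
    have : (p', v p') ∈ Φ '' Ω.graphOn u := himg ▸ mem_image_of_mem _ hp'
    obtain ⟨_, ⟨p, hp, rfl⟩, hz⟩ := this
    rw [h (hD (mem_image_of_mem _ hp))] at hz
    simp only [normalForm, Prod.mk.injEq] at hz
    obtain ⟨rfl, hz⟩ := hz
    have : baseMap (1 / s) c (-a - c * b) (-b)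
        (s * p.1 - c * (s ^ 3 * p.2) + a, s ^ 3 * p.2 + b) = p := by
      ext <;> simp only [baseMap] <;> field_simp <;> ring
    rw [this]
    exact ⟨hp, by rw [← hz]; ring⟩
  have hsub : Ω' ⊆ baseMap (1 / s) c (-a - c * b) (-b) ⁻¹' Ω := fun p hp => (key p hp).1
  have ht := hu.transform hΩ (1 / s) c (-a - c * b) (-b)
  exact IsSolutionOn.congr hΩ' ⟨ht.1.mono hsub, fun p hp => ht.2 p (hsub hp)⟩
    fun p hp => (key p hp).2

/-! ### Pulling the transformed equation back to the old independent variables. -/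

/-- The vector field `θ_t ∂_x - θ_x ∂_t` tangent to the level curves of `θ`. -/
noncomputable def lam (θ w : Base → ℝ) (p : Base) : ℝ :=
  pd (0, 1) θ p * pd (1, 0) w p - pd (1, 0) θ p * pd (0, 1) w p

theorem lam_congr {Ω : Set Base} (hΩ : IsOpen Ω) {θ w w' : Base → ℝ} (h : EqOn w w' Ω) :
    EqOn (lam θ w) (lam θ w') Ω := fun p hp => by
  simp only [lam, pd_congr hΩ h _ hp]

theorem lam_add {θ w w' : Base → ℝ} {p : Base} (hw : DifferentiableAt ℝ w p)
    (hw' : DifferentiableAt ℝ w' p) :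
    lam θ (fun p => w p + w' p) p = lam θ w p + lam θ w' p := by
  simp only [lam, pd_add hw hw']
  ring

theorem lam_mul {θ w w' : Base → ℝ} {p : Base} (hw : DifferentiableAt ℝ w p)
    (hw' : DifferentiableAt ℝ w' p) :
    lam θ (fun p => w p * w' p) p = lam θ w p * w' p + w p * lam θ w' p := by
  simp only [lam, pd_mul hw hw']
  ring

theorem lam_contDiffOn {Ω : Set Base} (hΩ : IsOpen Ω) {θ w : Base → ℝ} {m n : WithTop ℕ∞}
    (hθ : ContDiffOn ℝ n θ Ω) (hw : ContDiffOn ℝ n w Ω) (hmn : m + 1 ≤ n) :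
    ContDiffOn ℝ m (lam θ w) Ω :=
  ((pd_contDiffOn hΩ hθ hmn _).mul (pd_contDiffOn hΩ hw hmn _)).sub
    ((pd_contDiffOn hΩ hθ hmn _).mul (pd_contDiffOn hΩ hw hmn _))

theorem pd_comp_pair {ξ θ w : Base → ℝ} {p : Base} (hξ : DifferentiableAt ℝ ξ p)
    (hθ : DifferentiableAt ℝ θ p) (hw : DifferentiableAt ℝ w (ξ p, θ p)) (e : Base) :
    pd e (fun p => w (ξ p, θ p)) p
      = pd (1, 0) w (ξ p, θ p) * pd e ξ p + pd (0, 1) w (ξ p, θ p) * pd e θ p := by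
  have h := hw.hasFDerivAt.comp p (hξ.hasFDerivAt.prodMk hθ.hasFDerivAt)
  have h' : fderiv ℝ (fun p => w (ξ p, θ p)) p = _ := h.fderiv
  have e' : (fderiv ℝ ξ p e, fderiv ℝ θ p e)
      = fderiv ℝ ξ p e • ((1 : ℝ), (0 : ℝ)) + fderiv ℝ θ p e • ((0 : ℝ), (1 : ℝ)) := by simp
  simp only [pd, h', ContinuousLinearMap.comp_apply, ContinuousLinearMap.prod_apply]
  rw [e', map_add, map_smul, map_smul, smul_eq_mul, smul_eq_mul]
  ring

/-- `lam θ` annihilates `θ`, so only the `ξ`-derivative survives the chain rule: in the coordinates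
`(ξ, θ)` the operator is `lam θ ξ` times `∂_ξ`. -/
theorem lam_comp_pair {ξ θ w : Base → ℝ} {p : Base} (hξ : DifferentiableAt ℝ ξ p)
    (hθ : DifferentiableAt ℝ θ p) (hw : DifferentiableAt ℝ w (ξ p, θ p)) :
    lam θ (fun p => w (ξ p, θ p)) p = pd (1, 0) w (ξ p, θ p) * lam θ ξ p := by
  simp only [lam, pd_comp_pair hξ hθ hw]
  ring

/-- The inverse function theorem for a map of the plane in coordinates. -/
theorem exists_local_inverse {Ω : Set Base} (hΩ : IsOpen Ω) {ξ θ : Base → ℝ}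
    (hξ : ContDiffOn ℝ 3 ξ Ω) (hθ : ContDiffOn ℝ 3 θ Ω) {p₀ : Base} (hp₀ : p₀ ∈ Ω)
    (hJ : lam θ ξ p₀ ≠ 0) :
    ∃ (Ω₀ Ω' : Set Base) (H : Base → Base), IsOpen Ω₀ ∧ IsOpen Ω' ∧ p₀ ∈ Ω₀ ∧ Ω₀ ⊆ Ω ∧
      (fun p => (ξ p, θ p)) '' Ω₀ = Ω' ∧ ContDiffOn ℝ 3 H Ω' ∧ ∀ p ∈ Ω₀, H (ξ p, θ p) = p := by
  set G : Base → Base := fun p => (ξ p, θ p) with hG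
  have hGc : ContDiffOn ℝ 3 G Ω := hξ.prodMk hθ
  have hGp : ContDiffAt ℝ 3 G p₀ := hGc.contDiffAt (hΩ.mem_nhds hp₀)
  have dξ : DifferentiableAt ℝ ξ p₀ := (hξ.contDiffAt (hΩ.mem_nhds hp₀)).differentiableAt (by simp)
  have dθ : DifferentiableAt ℝ θ p₀ := (hθ.contDiffAt (hΩ.mem_nhds hp₀)).differentiableAt (by simp)
  set A : Base →L[ℝ] Base := (fderiv ℝ ξ p₀).prod (fderiv ℝ θ p₀) with hA
  have hAd : HasFDerivAt G A p₀ := dξ.hasFDerivAt.prodMk dθ.hasFDerivAt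
  have hinj : Function.Injective (A : Base →ₗ[ℝ] Base) := by
    rw [← LinearMap.ker_eq_bot, LinearMap.ker_eq_bot']
    intro q hq
    have hsplit : ∀ φ : Base →L[ℝ] ℝ, φ q = q.1 * φ (1, 0) + q.2 * φ (0, 1) := fun φ => by
      have : q = q.1 • ((1 : ℝ), (0 : ℝ)) + q.2 • ((0 : ℝ), (1 : ℝ)) := by simp
      conv_lhs => rw [this, map_add, map_smul, map_smul, smul_eq_mul, smul_eq_mul]
    have hq' : (fderiv ℝ ξ p₀ q, fderiv ℝ θ p₀ q) = ((0 : ℝ), (0 : ℝ)) := hq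
    rw [Prod.mk.injEq, hsplit, hsplit] at hq'
    obtain ⟨h1, h2⟩ := hq'
    simp only [lam, pd] at hJ
    have e1 : q.1 = 0 := by
      refine (mul_eq_zero.1 ?_).resolve_right hJ
      linear_combination fderiv ℝ θ p₀ (0, 1) * h1 - fderiv ℝ ξ p₀ (0, 1) * h2
    have e2 : q.2 = 0 := by
      refine (mul_eq_zero.1 ?_).resolve_right hJ
      linear_combination fderiv ℝ ξ p₀ (1, 0) * h2 - fderiv ℝ θ p₀ (1, 0) * h1
    exact Prod.ext e1 e2
  set A' : Base ≃L[ℝ] Base :=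
    (LinearEquiv.ofInjectiveEndo (A : Base →ₗ[ℝ] Base) hinj).toContinuousLinearEquiv
  have hAd' : HasFDerivAt G (A' : Base →L[ℝ] Base) p₀ := by
    rwa [show (A' : Base →L[ℝ] Base) = A from ContinuousLinearMap.ext fun _ => rfl]
  let φ := hGp.toOpenPartialHomeomorph G hAd' (by simp)
  have hφ : (φ : Base → Base) = G := rfl
  have hsrc : p₀ ∈ φ.source := hGp.mem_toOpenPartialHomeomorph_source hAd' (by simp)
  have hH : ContDiffAt ℝ 3 φ.symm (G p₀) := hGp.to_localInverse hAd' (by simp)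
  obtain ⟨N, hN, hHN⟩ := hH.contDiffOn (m := 3) le_rfl (by simp)
  obtain ⟨N', hN', hN'o, hN'p⟩ := mem_nhds_iff.1 hN
  have ho : IsOpen (φ.source ∩ φ ⁻¹' N') := φ.isOpen_inter_preimage hN'o
  have ho' : IsOpen (φ.source ∩ φ ⁻¹' N' ∩ Ω) := ho.inter hΩ
  refine ⟨φ.source ∩ φ ⁻¹' N' ∩ Ω, φ '' (φ.source ∩ φ ⁻¹' N' ∩ Ω), φ.symm, ho',
    φ.isOpen_image_of_subset_source ho' (fun p hp => hp.1.1), ⟨⟨hsrc, hN'p⟩, hp₀⟩,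
    fun p hp => hp.2, rfl, hHN.mono ?_, fun p hp => φ.left_inv hp.1.1⟩
  rintro _ ⟨p, hp, rfl⟩
  exact hN' hp.1.2

/-- The KdV equation for the image of a solution, pulled back to the original variables. -/
theorem IsSymmetryOn.pullback_identity {D : Set Total} {X T U : Total → ℝ}
    (hsym : IsSymmetryOn D fun z => ((X z, T z), U z)) {Ω : Set Base} (hΩ : IsOpen Ω)
    {u ξ θ η : Base → ℝ} (hu : IsSolutionOn Ω u) (hD : Ω.graphOn u ⊆ D)
    (hξ : ContDiffOn ℝ 3 ξ Ω) (hθ : ContDiffOn ℝ 3 θ Ω) (hη : ContDiffOn ℝ 3 η Ω)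
    (hX : ∀ p ∈ Ω, X (p, u p) = ξ p) (hT : ∀ p ∈ Ω, T (p, u p) = θ p)
    (hU : ∀ p ∈ Ω, U (p, u p) = η p) {p : Base} (hp : p ∈ Ω) (hJ : lam θ ξ p ≠ 0) :
    (pd (1, 0) ξ p * pd (0, 1) η p - pd (0, 1) ξ p * pd (1, 0) η p) * lam θ ξ p ^ 4
      + 6 * η p * lam θ η p * lam θ ξ p ^ 4
      + lam θ ξ p * (lam θ (lam θ (lam θ η)) p * lam θ ξ p
        - lam θ η p * lam θ (lam θ (lam θ ξ)) p)
      - 3 * (lam θ (lam θ η) p * lam θ ξ p - lam θ η p * lam θ (lam θ ξ) p)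
        * lam θ (lam θ ξ) p = 0 := by
  obtain ⟨Ω₀, Ω', H, ho, ho', hp₀, hsub, himg, hH, hinv⟩ := exists_local_inverse hΩ hξ hθ hp hJ
  set v : Base → ℝ := fun q => η (H q) with hv
  have hmaps : ∀ q ∈ Ω₀, (ξ q, θ q) ∈ Ω' := fun q hq => himg ▸ mem_image_of_mem _ hq
  have hvc : ContDiffOn ℝ 3 v Ω' := hη.comp hH fun q hq => by
    rw [← himg] at hq
    obtain ⟨q', hq', rfl⟩ := hq
    simpa [hinv q' hq'] using hsub hq'
  have hvη : ∀ q ∈ Ω₀, v (ξ q, θ q) = η q := fun q hq => by simp only [hv, hinv q hq]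
  have hsol : IsSolutionOn Ω' v := by
    refine hsym Ω₀ Ω' u v ho ho' ⟨hu.1.mono hsub, fun q hq => hu.2 q (hsub hq)⟩
      ((image_mono hsub).trans hD) hvc ?_
    rw [← himg, graphOn, graphOn, image_image, image_image]
    refine image_congr fun q hq => ?_
    simp only [hX q (hsub hq), hT q (hsub hq), hU q (hsub hq), hvη q hq]
  have hξ := hξ.mono hsub
  have hθ := hθ.mono hsub
  have hη := hη.mono hsub
  have da : ∀ {w : Base → ℝ} {S : Set Base} {n : WithTop ℕ∞} {q : Base}, IsOpen S →
      ContDiffOn ℝ n w S → n ≠ 0 → q ∈ S → DifferentiableAt ℝ w q := fun hS hw hn hq =>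
    (hw.contDiffAt (hS.mem_nhds hq)).differentiableAt hn
  have hJ1 : ContDiffOn ℝ 2 (lam θ ξ) Ω₀ := lam_contDiffOn ho hθ hξ (by norm_num)
  have hJ2 : ContDiffOn ℝ 1 (lam θ (lam θ ξ)) Ω₀ :=
    lam_contDiffOn ho (hθ.of_le (by norm_num)) hJ1 (by norm_num)
  have hv1 : ContDiffOn ℝ 2 (pd (1, 0) v) Ω' := pd_contDiffOn ho' hvc (by norm_num) _
  have hv2 : ContDiffOn ℝ 1 (pd (1, 0) (pd (1, 0) v)) Ω' := pd_contDiffOn ho' hv1 (by norm_num) _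
  have hG : ContDiffOn ℝ 3 (fun q => (ξ q, θ q)) Ω₀ := hξ.prodMk hθ
  have hw1 : ContDiffOn ℝ 2 (fun q => pd (1, 0) v (ξ q, θ q)) Ω₀ :=
    hv1.comp (hG.of_le (by norm_num)) hmaps
  have hw2 : ContDiffOn ℝ 1 (fun q => pd (1, 0) (pd (1, 0) v) (ξ q, θ q)) Ω₀ :=
    hv2.comp (hG.of_le (by norm_num)) hmaps
  have chain : ∀ {w : Base → ℝ} {n : WithTop ℕ∞}, ContDiffOn ℝ n w Ω' → n ≠ 0 → ∀ q ∈ Ω₀,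
      lam θ (fun q => w (ξ q, θ q)) q = pd (1, 0) w (ξ q, θ q) * lam θ ξ q :=
    fun hw hn q hq => lam_comp_pair (da ho hξ (by simp) hq) (da ho hθ (by simp) hq)
      (da ho' hw hn (hmaps q hq))
  have e1 : EqOn (lam θ η) (fun q => pd (1, 0) v (ξ q, θ q) * lam θ ξ q) Ω₀ := fun q hq => by
    beta_reduce
    rw [← chain hvc (by simp) q hq]
    exact lam_congr ho (fun q hq => (hvη q hq).symm) hq
  have e2 : EqOn (lam θ (lam θ η)) (fun q => pd (1, 0) (pd (1, 0) v) (ξ q, θ q)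
      * (lam θ ξ q * lam θ ξ q) + pd (1, 0) v (ξ q, θ q) * lam θ (lam θ ξ) q) Ω₀ := fun q hq => by
    rw [lam_congr ho e1 hq, lam_mul (da ho hw1 (by simp) hq) (da ho hJ1 (by simp) hq),
      chain hv1 (by simp) q hq]
    ring
  have e3 : lam θ (lam θ (lam θ η)) p
      = pd (1, 0) (pd (1, 0) (pd (1, 0) v)) (ξ p, θ p) * lam θ ξ p ^ 3
      + 3 * pd (1, 0) (pd (1, 0) v) (ξ p, θ p) * lam θ ξ p * lam θ (lam θ ξ) p
      + pd (1, 0) v (ξ p, θ p) * lam θ (lam θ (lam θ ξ)) p := by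
    have d0 := da ho hJ1 (by simp) hp₀
    have d1 := da ho hJ2 (by simp) hp₀
    have d2 := da ho hw1 (by simp) hp₀
    have d3 := da ho hw2 (by simp) hp₀
    have d4 : DifferentiableAt ℝ (fun q => lam θ ξ q * lam θ ξ q) p := d0.mul d0
    have d5 : DifferentiableAt ℝ (fun q => pd (1, 0) (pd (1, 0) v) (ξ q, θ q)
      * (lam θ ξ q * lam θ ξ q)) p := d3.mul d4
    have d6 : DifferentiableAt ℝ (fun q => pd (1, 0) v (ξ q, θ q) * lam θ (lam θ ξ) q) p :=
      d2.mul d1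
    rw [lam_congr ho e2 hp₀, lam_add d5 d6, lam_mul d3 d4,
      lam_mul d0 d0, lam_mul d2 d1, chain hv1 (by simp) p hp₀, chain hv2 (by simp) p hp₀]
    ring
  -- The time derivative of `v` by Cramer's rule, the Jacobian being `lam θ ξ`.
  have et : pd (1, 0) ξ p * pd (0, 1) η p - pd (0, 1) ξ p * pd (1, 0) η p
      = pd (0, 1) v (ξ p, θ p) * lam θ ξ p := by
    have h := pd_comp_pair (da ho hξ (by simp) hp₀) (da ho hθ (by simp) hp₀)
      (da ho' hvc (by simp) (hmaps p hp₀))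
    have hc := pd_congr ho (fun q hq => (hvη q hq).symm)
    rw [hc (0, 1) hp₀, hc (1, 0) hp₀, h, h]
    simp only [lam]
    ring
  have hk := hsol.2 _ (hmaps p hp₀)
  rw [kdvExpr_eq ho' hvc (hmaps p hp₀), hvη p hp₀] at hk
  have e1 := e1 hp₀
  have e2 := e2 hp₀
  simp only at e1 e2
  rw [et, e3, e2, e1]
  -- The fifth power clears the denominators in the third `ξ`-derivative of `v`.
  linear_combination lam θ ξ p ^ 5 * hk

/-! ### Stationary solutions and iterates of `lam` along their graphs. -/

/-- Stationary solutions of KdV, together with their first two derivatives. -/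
structure IsWaveOn (I : Set ℝ) (f f₁ f₂ : ℝ → ℝ) : Prop where
  deriv₀ : ∀ x ∈ I, HasDerivAt f (f₁ x) x
  deriv₁ : ∀ x ∈ I, HasDerivAt f₁ (f₂ x) x
  deriv₂ : ∀ x ∈ I, HasDerivAt f₂ (-6 * f x * f₁ x) x

/-- The equation is a third-order ODE with smooth right-hand side, so the value and the first two
derivatives at a point are free; this freedom makes `p` and `q` independent variables later. -/
theorem exists_isWaveOn (x₀ k p q : ℝ) : ∃ (I : Set ℝ) (f f₁ f₂ : ℝ → ℝ), IsOpen I ∧ x₀ ∈ I ∧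
    IsWaveOn I f f₁ f₂ ∧ f x₀ = k ∧ f₁ x₀ = p ∧ f₂ x₀ = q := by
  let F : ℝ × ℝ × ℝ → ℝ × ℝ × ℝ := fun y => (y.2.1, y.2.2, -6 * y.1 * y.2.1)
  have hF : ContDiffAt ℝ 1 F (k, p, q) := by
    apply ContDiff.contDiffAt
    fun_prop
  obtain ⟨α, hα, ε, hε, h⟩ :=
    hF.exists_forall_mem_closedBall_exists_eq_forall_mem_Ioo_hasDerivAt₀ x₀
  refine ⟨Ioo (x₀ - ε) (x₀ + ε), fun x => (α x).1, fun x => (α x).2.1, fun x => (α x).2.2,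
    isOpen_Ioo, by simpa using hε, ⟨?_, ?_, ?_⟩, by simp [hα], by simp [hα], by simp [hα]⟩
  · exact fun x hx => (h x hx).fst
  · exact fun x hx => (h x hx).snd.fst
  · exact fun x hx => (h x hx).snd.snd

/-- The coordinate vector `∂_x`. -/
def ex : Total := ((1, 0), 0)

/-- The coordinate vector `∂_t`. -/
def et : Total := ((0, 1), 0)

/-- The coordinate vector `∂_u`. -/
def eu : Total := ((0, 0), 1)

/-- The part of `lam` on graphs `u = f x` that is free of `f'`. -/
noncomputable def op0 (T g : Total → ℝ) (z : Total) : ℝ :=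
  pd et T z * pd ex g z - pd ex T z * pd et g z

/-- The coefficient of `f'` in `lam` on graphs `u = f x`. -/
noncomputable def op1 (T g : Total → ℝ) (z : Total) : ℝ :=
  pd et T z * pd eu g z - pd eu T z * pd et g z

theorem op0_smooth {D : Set Total} (hD : IsOpen D) {T g : Total → ℝ} (hT : ContDiffOn ℝ ∞ T D)
    (hg : ContDiffOn ℝ ∞ g D) : ContDiffOn ℝ ∞ (op0 T g) D :=
  ((pd_smooth hD hT _).mul (pd_smooth hD hg _)).sub ((pd_smooth hD hT _).mul (pd_smooth hD hg _))

theorem op1_smooth {D : Set Total} (hD : IsOpen D) {T g : Total → ℝ} (hT : ContDiffOn ℝ ∞ T D)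
    (hg : ContDiffOn ℝ ∞ g D) : ContDiffOn ℝ ∞ (op1 T g) D :=
  ((pd_smooth hD hT _).mul (pd_smooth hD hg _)).sub ((pd_smooth hD hT _).mul (pd_smooth hD hg _))

theorem op0_congr {D : Set Total} (hD : IsOpen D) {T g h : Total → ℝ} (H : EqOn g h D) :
    EqOn (op0 T g) (op0 T h) D := fun z hz => by
  simp only [op0, pd_congr hD H _ hz]

theorem op1_congr {D : Set Total} (hD : IsOpen D) {T g h : Total → ℝ} (H : EqOn g h D) :
    EqOn (op1 T g) (op1 T h) D := fun z hz => by
  simp only [op1, pd_congr hD H _ hz]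

section Graph

variable {f : ℝ → ℝ} {f' : ℝ} {g : Total → ℝ} {p : Base}

theorem hasFDerivAt_comp_graph (hf : HasDerivAt f f' p.1) (hg : DifferentiableAt ℝ g (p, f p.1)) :
    HasFDerivAt (fun p : Base => g (p, f p.1)) ((fderiv ℝ g (p, f p.1)).comp
      ((ContinuousLinearMap.id ℝ Base).prod (f' • ContinuousLinearMap.fst ℝ ℝ ℝ))) p := by
  have h1 : HasFDerivAt (fun p : Base => p.1) (ContinuousLinearMap.fst ℝ ℝ ℝ) p := hasFDerivAt_fst
  exact hg.hasFDerivAt.comp p ((hasFDerivAt_id p).prodMk (hf.comp_hasFDerivAt p h1))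

theorem pd_fst_graph (hf : HasDerivAt f f' p.1) (hg : DifferentiableAt ℝ g (p, f p.1)) :
    pd (1, 0) (fun p : Base => g (p, f p.1)) p
      = pd ex g (p, f p.1) + f' * pd eu g (p, f p.1) := by
  have e : ((ContinuousLinearMap.id ℝ Base).prod (f' • ContinuousLinearMap.fst ℝ ℝ ℝ))
      (1, 0) = ex + f' • eu := by simp [ex, eu]
  simp only [pd, (hasFDerivAt_comp_graph hf hg).fderiv, ContinuousLinearMap.comp_apply]
  rw [e, map_add, map_smul, smul_eq_mul]

theorem pd_snd_graph (hf : HasDerivAt f f' p.1) (hg : DifferentiableAt ℝ g (p, f p.1)) :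
    pd (0, 1) (fun p : Base => g (p, f p.1)) p = pd et g (p, f p.1) := by
  have e : ((ContinuousLinearMap.id ℝ Base).prod (f' • ContinuousLinearMap.fst ℝ ℝ ℝ))
      (0, 1) = et := by simp [et]
  simp only [pd, (hasFDerivAt_comp_graph hf hg).fderiv, ContinuousLinearMap.comp_apply]
  rw [e]

theorem lam_graph {T : Total → ℝ} (hf : HasDerivAt f f' p.1)
    (hT : DifferentiableAt ℝ T (p, f p.1)) (hg : DifferentiableAt ℝ g (p, f p.1)) :
    lam (fun p => T (p, f p.1)) (fun p => g (p, f p.1)) p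
      = op0 T g (p, f p.1) + f' * op1 T g (p, f p.1) := by
  simp only [lam, pd_fst_graph hf hT, pd_snd_graph hf hT, pd_fst_graph hf hg, pd_snd_graph hf hg,
    op0, op1]
  ring

theorem lam_fst {θ : Base → ℝ} {h : ℝ → ℝ} {h' : ℝ} (hh : HasDerivAt h h' p.1) :
    lam θ (fun p => h p.1) p = pd (0, 1) θ p * h' := by
  have h1 : HasFDerivAt (fun p : Base => p.1) (ContinuousLinearMap.fst ℝ ℝ ℝ) p := hasFDerivAt_fst
  have h2 : fderiv ℝ (fun p : Base => h p.1) p = _ := (hh.comp_hasFDerivAt p h1).fderiv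
  simp [lam, pd, h2]

end Graph

/-- `lam` of a function of `(x, t, u)` on the jet with `u_x = p`. -/
noncomputable def lam1 (T g : Total → ℝ) (z : Total) (p : ℝ) : ℝ := op0 T g z + p * op1 T g z

/-- The second iterate of `lam` on the jet with `u_x = p`, `u_xx = q`. -/
noncomputable def lam2 (T g : Total → ℝ) (z : Total) (p q : ℝ) : ℝ :=
  op0 T (op0 T g) z + p * (op1 T (op0 T g) z + op0 T (op1 T g) z) + p ^ 2 * op1 T (op1 T g) z
    + q * pd et T z * op1 T g z

/-- The third iterate of `lam` on the stationary jet with `u_x = p`, `u_xx = q`. -/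
noncomputable def lam3 (T g : Total → ℝ) (z : Total) (p q : ℝ) : ℝ :=
  op0 T (op0 T (op0 T g)) z
    + p * (op1 T (op0 T (op0 T g)) z + op0 T (op1 T (op0 T g)) z + op0 T (op0 T (op1 T g)) z)
    + p ^ 2 * (op1 T (op1 T (op0 T g)) z + op1 T (op0 T (op1 T g)) z + op0 T (op1 T (op1 T g)) z)
    + p ^ 3 * op1 T (op1 T (op1 T g)) z
    + q * pd et T z * (op1 T (op0 T g) z + op0 T (op1 T g) z + 2 * p * op1 T (op1 T g) z)
    + q * (op0 T (fun z => pd et T z * op1 T g z) z + p * op1 T (fun z => pd et T z * op1 T g z) z)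
    - 6 * z.2 * p * pd et T z ^ 2 * op1 T g z

/-- Each application sends a function of `(x, t, u)` to `op0 + f' op1`, while `f'` and `f''`,
depending on `x` alone, are differentiated as `T_t f''` and `T_t f'''`. The ODE eliminates `f'''`.
-/
theorem lam_lam_graph {D : Set Total} (hD : IsOpen D) {T g : Total → ℝ} (hT : ContDiffOn ℝ ∞ T D)
    (hg : ContDiffOn ℝ ∞ g D) {I : Set ℝ} {f f₁ f₂ : ℝ → ℝ} (hf : IsWaveOn I f f₁ f₂) {Ω : Set Base}
    (hΩ : IsOpen Ω) (hI : ∀ p ∈ Ω, p.1 ∈ I) (hΩD : ∀ p ∈ Ω, (p, f p.1) ∈ D) :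
    EqOn (lam (fun p => T (p, f p.1)) (fun p => g (p, f p.1)))
        (fun p => lam1 T g (p, f p.1) (f₁ p.1)) Ω ∧
      EqOn (lam (fun p => T (p, f p.1)) (lam (fun p => T (p, f p.1)) (fun p => g (p, f p.1))))
        (fun p => lam2 T g (p, f p.1) (f₁ p.1) (f₂ p.1)) Ω ∧
      EqOn (lam (fun p => T (p, f p.1))
          (lam (fun p => T (p, f p.1)) (lam (fun p => T (p, f p.1)) (fun p => g (p, f p.1)))))
        (fun p => lam3 T g (p, f p.1) (f₁ p.1) (f₂ p.1)) Ω := by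
  have s0 := op0_smooth hD hT hg
  have s1 := op1_smooth hD hT hg
  have da : ∀ {h : Total → ℝ}, ContDiffOn ℝ ∞ h D → ∀ p ∈ Ω, DifferentiableAt ℝ h (p, f p.1) :=
    fun hh p hp => (hh.contDiffAt (hD.mem_nhds (hΩD p hp))).differentiableAt (by simp)
  have hl : ∀ {h : Total → ℝ}, ContDiffOn ℝ ∞ h D → ∀ p ∈ Ω,
      lam (fun p => T (p, f p.1)) (fun p => h (p, f p.1)) p
        = op0 T h (p, f p.1) + f₁ p.1 * op1 T h (p, f p.1) := fun hh p hp =>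
    lam_graph (hf.deriv₀ _ (hI p hp)) (da hT p hp) (da hh p hp)
  have dg : ∀ {h : Total → ℝ}, ContDiffOn ℝ ∞ h D → ∀ p ∈ Ω,
      DifferentiableAt ℝ (fun p : Base => h (p, f p.1)) p := fun hh p hp =>
    (hasFDerivAt_comp_graph (hf.deriv₀ _ (hI p hp)) (da hh p hp)).differentiableAt
  have d1 : ∀ p ∈ Ω, DifferentiableAt ℝ (fun p : Base => f₁ p.1) p := fun p hp =>
    (hf.deriv₁ _ (hI p hp)).differentiableAt.comp p differentiableAt_fst
  have d2 : ∀ p ∈ Ω, DifferentiableAt ℝ (fun p : Base => f₂ p.1) p := fun p hp =>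
    (hf.deriv₂ _ (hI p hp)).differentiableAt.comp p differentiableAt_fst
  have l1 : ∀ p ∈ Ω, lam (fun p => T (p, f p.1)) (fun p => f₁ p.1) p
      = pd et T (p, f p.1) * f₂ p.1 := fun p hp => by
    rw [lam_fst (hf.deriv₁ _ (hI p hp)), pd_snd_graph (hf.deriv₀ _ (hI p hp)) (da hT p hp)]
  have l2 : ∀ p ∈ Ω, lam (fun p => T (p, f p.1)) (fun p => f₂ p.1) p
      = pd et T (p, f p.1) * (-6 * f p.1 * f₁ p.1) := fun p hp => by
    rw [lam_fst (hf.deriv₂ _ (hI p hp)), pd_snd_graph (hf.deriv₀ _ (hI p hp)) (da hT p hp)]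
  have e1 : EqOn (lam (fun p => T (p, f p.1)) (fun p => g (p, f p.1)))
      (fun p => op0 T g (p, f p.1) + f₁ p.1 * op1 T g (p, f p.1)) Ω := fun p hp => hl hg p hp
  have hB : ContDiffOn ℝ ∞ (fun z => pd et T z * op1 T g z) D := (pd_smooth hD hT _).mul s1
  have e2 : EqOn
      (lam (fun p => T (p, f p.1)) (lam (fun p => T (p, f p.1)) (fun p => g (p, f p.1))))
      (fun p => op0 T (op0 T g) (p, f p.1)
        + (f₁ p.1 * op1 T (op0 T g) (p, f p.1) + (f₁ p.1 * op0 T (op1 T g) (p, f p.1)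
        + (f₁ p.1 * (f₁ p.1 * op1 T (op1 T g) (p, f p.1))
        + f₂ p.1 * (fun z => pd et T z * op1 T g z) (p, f p.1))))) Ω := fun p hp => by
    have a1 := (d1 p hp).fun_mul (dg s1 p hp)
    rw [lam_congr hΩ e1 hp, lam_add (dg s0 p hp) a1, lam_mul (d1 p hp) (dg s1 p hp), l1 p hp,
      hl s0 p hp, hl s1 p hp]
    ring
  refine ⟨e1, fun p hp => ?_, fun p hp => ?_⟩
  · rw [e2 hp]
    simp only [lam2]
    ring
  · have s00 := op0_smooth hD hT s0
    have s10 := op1_smooth hD hT s0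
    have s01 := op0_smooth hD hT s1
    have s11 := op1_smooth hD hT s1
    have b1 := (d1 p hp).fun_mul (dg s10 p hp)
    have b2 := (d1 p hp).fun_mul (dg s01 p hp)
    have b3 := (d1 p hp).fun_mul (dg s11 p hp)
    have b4 := (d1 p hp).fun_mul b3
    have b5 := (d2 p hp).fun_mul (dg hB p hp)
    have b6 := b4.fun_add b5
    have b7 := b2.fun_add b6
    have b8 := b1.fun_add b7
    rw [lam_congr hΩ e2 hp, lam_add (dg s00 p hp) b8, lam_add b1 b7, lam_add b2 b6, lam_add b4 b5,
      lam_mul (d1 p hp) (dg s10 p hp), lam_mul (d1 p hp) (dg s01 p hp), lam_mul (d1 p hp) b3,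
      lam_mul (d1 p hp) (dg s11 p hp), lam_mul (d2 p hp) (dg hB p hp), l1 p hp, l2 p hp,
      hl s00 p hp, hl s10 p hp, hl s01 p hp, hl s11 p hp, hl hB p hp]
    simp only [lam3]
    ring

/-! ### Point symmetries, the determining equation and conjugation by boosts. -/

/-- A point transformation `(x, t, u) ↦ (X, T, U)` of `D` that is a symmetry of KdV. -/
structure IsPointSymmetry (D : Set Total) (X T U : Total → ℝ) : Prop where
  isOpen : IsOpen D
  smoothX : ContDiffOn ℝ ∞ X D
  smoothT : ContDiffOn ℝ ∞ T D
  smoothU : ContDiffOn ℝ ∞ U D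
  sym : IsSymmetryOn D fun z => ((X z, T z), U z)
  det : ∀ z ∈ D, pd ex X z * (pd et T z * pd eu U z - pd eu T z * pd et U z)
    - pd et X z * (pd ex T z * pd eu U z - pd eu T z * pd ex U z)
    + pd eu X z * (pd ex T z * pd et U z - pd et T z * pd ex U z) ≠ 0

theorem IsPointSymmetry.mono {D D' : Set Total} {X T U : Total → ℝ} (h : IsPointSymmetry D X T U)
    (hD' : IsOpen D') (hsub : D' ⊆ D) : IsPointSymmetry D' X T U where
  isOpen := hD'
  smoothX := h.smoothX.mono hsub
  smoothT := h.smoothT.mono hsub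
  smoothU := h.smoothU.mono hsub
  sym := fun Ω Ω' u v h1 h2 h3 h4 => h.sym Ω Ω' u v h1 h2 h3 (h4.trans hsub)
  det := fun z hz => h.det z (hsub hz)

/-- The determining equation on stationary jets. -/
theorem IsPointSymmetry.jet_identity {D : Set Total} {X T U : Total → ℝ}
    (h : IsPointSymmetry D X T U) {z : Total} (hz : z ∈ D) (p q : ℝ) (hJ : lam1 T X z p ≠ 0) :
    (pd ex X z * pd et U z - pd et X z * pd ex U z
        + p * (pd eu X z * pd et U z - pd et X z * pd eu U z)) * lam1 T X z p ^ 4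
      + 6 * U z * lam1 T U z p * lam1 T X z p ^ 4
      + lam1 T X z p * (lam3 T U z p q * lam1 T X z p - lam1 T U z p * lam3 T X z p q)
      - 3 * (lam2 T U z p q * lam1 T X z p - lam1 T U z p * lam2 T X z p q)
        * lam2 T X z p q = 0 := by
  obtain ⟨⟨x₀, t₀⟩, k⟩ := z
  obtain ⟨I, f, f₁, f₂, hI, hx₀, hf, rfl, rfl, rfl⟩ := exists_isWaveOn x₀ k p q
  have hfc : ContinuousOn f I := fun x hx => (hf.deriv₀ x hx).continuousAt.continuousWithinAt
  have hgr : ContinuousOn (fun p : Base => (p, f p.1)) (Prod.fst ⁻¹' I) :=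
    continuousOn_id.prodMk (hfc.comp continuousOn_fst fun _ h => h)
  have hΩ := hgr.isOpen_inter_preimage (hI.preimage continuous_fst) h.isOpen
  set Ω : Set Base := Prod.fst ⁻¹' I ∩ (fun p : Base => (p, f p.1)) ⁻¹' D with hΩdef
  have hΩI : ∀ p ∈ Ω, p.1 ∈ I := fun p hp => hp.1
  have hΩD : ∀ p ∈ Ω, (p, f p.1) ∈ D := fun p hp => hp.2
  have hp₀ : ((x₀, t₀) : Base) ∈ Ω := ⟨hx₀, hz⟩
  have hc0 : ContDiffOn ℝ 1 f₂ I := by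
    have h0 : ContinuousOn (deriv f₂) I := by
      have : ContinuousOn (fun x => -6 * f x * f₁ x) I :=
        (continuousOn_const.mul hfc).mul fun x hx =>
          (hf.deriv₁ x hx).continuousAt.continuousWithinAt
      exact this.congr fun x hx => (hf.deriv₂ x hx).deriv
    rw [show (1 : WithTop ℕ∞) = 0 + 1 by norm_num, contDiffOn_succ_iff_deriv_of_isOpen hI]
    exact ⟨fun x hx => (hf.deriv₂ x hx).differentiableAt.differentiableWithinAt, by simp,
      contDiffOn_zero.2 h0⟩
  have hc1 : ContDiffOn ℝ 2 f₁ I := by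
    rw [show (2 : WithTop ℕ∞) = 1 + 1 by norm_num, contDiffOn_succ_iff_deriv_of_isOpen hI]
    exact ⟨fun x hx => (hf.deriv₁ x hx).differentiableAt.differentiableWithinAt, by simp,
      hc0.congr fun x hx => (hf.deriv₁ x hx).deriv⟩
  have hc2 : ContDiffOn ℝ 3 f I := by
    rw [show (3 : WithTop ℕ∞) = 2 + 1 by norm_num, contDiffOn_succ_iff_deriv_of_isOpen hI]
    exact ⟨fun x hx => (hf.deriv₀ x hx).differentiableAt.differentiableWithinAt, by simp,
      hc1.congr fun x hx => (hf.deriv₀ x hx).deriv⟩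
  have hu : ContDiffOn ℝ 3 (fun p : Base => f p.1) Ω := hc2.comp contDiffOn_fst hΩI
  have hsol : IsSolutionOn Ω (fun p => f p.1) := by
    refine ⟨hu, fun p hp => ?_⟩
    have hnear : ∀ᶠ x in 𝓝 p.1, x ∈ I := hI.mem_nhds (hΩI p hp)
    have a1 : deriv f =ᶠ[𝓝 p.1] f₁ := hnear.mono fun x hx => (hf.deriv₀ x hx).deriv
    have a2 : deriv (deriv f) =ᶠ[𝓝 p.1] f₂ := by
      filter_upwards [a1.eventuallyEq_nhds, hnear] with x hx hxI
      rw [hx.deriv_eq, (hf.deriv₁ x hxI).deriv]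
    have a3 : deriv (deriv (deriv f)) p.1 = -6 * f p.1 * f₁ p.1 := by
      rw [a2.deriv_eq, (hf.deriv₂ _ (hΩI p hp)).deriv]
    simp only [kdvExpr, iteratedDeriv_succ, iteratedDeriv_zero, deriv_const]
    rw [a3, a1.eq_of_nhds]
    ring
  have hgrc : ContDiffOn ℝ 3 (fun p : Base => (p, f p.1)) Ω := contDiffOn_id.prodMk hu
  have hs : ∀ {g : Total → ℝ}, ContDiffOn ℝ ∞ g D →
      ContDiffOn ℝ 3 (fun p : Base => g (p, f p.1)) Ω := fun hg =>
    (hg.of_le (WithTop.coe_le_coe.2 (le_top : (3 : ℕ∞) ≤ ⊤))).comp hgrc hΩD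
  obtain ⟨X1, X2, X3⟩ := lam_lam_graph h.isOpen h.smoothT h.smoothX hf hΩ hΩI hΩD
  obtain ⟨U1, U2, U3⟩ := lam_lam_graph h.isOpen h.smoothT h.smoothU hf hΩ hΩI hΩD
  have dX := (h.smoothX.contDiffAt (h.isOpen.mem_nhds hz)).differentiableAt (by simp)
  have dU := (h.smoothU.contDiffAt (h.isOpen.mem_nhds hz)).differentiableAt (by simp)
  have df := hf.deriv₀ x₀ hx₀
  have key := h.sym.pullback_identity hΩ hsol (by rintro _ ⟨p, hp, rfl⟩; exact hΩD p hp)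
    (hs h.smoothX) (hs h.smoothT) (hs h.smoothU) (fun _ _ => rfl) (fun _ _ => rfl)
    (fun _ _ => rfl) hp₀ (by rw [X1 hp₀]; exact hJ)
  rw [X1 hp₀, X2 hp₀, X3 hp₀, U1 hp₀, U2 hp₀, U3 hp₀,
    pd_fst_graph (p := (x₀, t₀)) df dX, pd_snd_graph (p := (x₀, t₀)) df dX,
    pd_fst_graph (p := (x₀, t₀)) df dU, pd_snd_graph (p := (x₀, t₀)) df dU] at key
  simp only at key
  linear_combination key

theorem galileanBoost_hasFDerivAt (c : ℝ) (z : Total) :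
    HasFDerivAt (galileanBoost c)
      (((ContinuousLinearMap.fst ℝ ℝ ℝ - c • ContinuousLinearMap.snd ℝ ℝ ℝ).prod
        (ContinuousLinearMap.snd ℝ ℝ ℝ)).prodMap (ContinuousLinearMap.id ℝ ℝ)) z := by
  have h1 : HasFDerivAt (fun z : Total => z.1) (ContinuousLinearMap.fst ℝ Base ℝ) z :=
    hasFDerivAt_fst
  have h2 : HasFDerivAt (fun z : Total => z.2) (ContinuousLinearMap.snd ℝ Base ℝ) z :=
    hasFDerivAt_snd
  exact ((h1.fst.sub (h1.snd.const_mul c)).prodMk h1.snd).prodMk (h2.sub_const (c / 6))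

theorem galileanBoost_contDiff (c : ℝ) {n : WithTop ℕ∞} : ContDiff ℝ n (galileanBoost c) := by
  unfold galileanBoost
  fun_prop

section Boost

variable {c : ℝ} {g : Total → ℝ} {z : Total}

theorem pd_comp_galileanBoost (hg : DifferentiableAt ℝ g (galileanBoost c z)) (e : Total) :
    pd e (g ∘ galileanBoost c) z
      = pd ((e.1.1 - c * e.1.2, e.1.2), e.2) g (galileanBoost c z) := by
  have h := (hg.hasFDerivAt.comp z (galileanBoost_hasFDerivAt c z)).fderiv
  simp only [pd, h]
  rfl

theorem pd_ex_boost (hg : DifferentiableAt ℝ g (galileanBoost c z)) :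
    pd ex (g ∘ galileanBoost c) z = pd ex g (galileanBoost c z) := by
  simp [pd_comp_galileanBoost hg, ex]

theorem pd_eu_boost (hg : DifferentiableAt ℝ g (galileanBoost c z)) :
    pd eu (g ∘ galileanBoost c) z = pd eu g (galileanBoost c z) := by
  simp [pd_comp_galileanBoost hg, eu]

theorem pd_et_boost (hg : DifferentiableAt ℝ g (galileanBoost c z)) :
    pd et (g ∘ galileanBoost c) z
      = pd et g (galileanBoost c z) - c * pd ex g (galileanBoost c z) := by
  have e : (((0 - c * 1 : ℝ), (1 : ℝ)), (0 : ℝ)) = et - c • ex := by simp [et, ex]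
  rw [pd_comp_galileanBoost hg, show (et.1.1 : ℝ) = 0 from rfl, show (et.1.2 : ℝ) = 1 from rfl,
    show (et.2 : ℝ) = 0 from rfl, e, pd, map_sub, map_smul, smul_eq_mul, pd, pd]

end Boost

/-- A boost carries graphs of solutions to graphs of solutions. Testing the boosted symmetry on
stationary solutions amounts to testing the original one on travelling waves. -/
theorem IsPointSymmetry.boost {D : Set Total} {X T U : Total → ℝ} (h : IsPointSymmetry D X T U)
    (c : ℝ) : IsPointSymmetry (galileanBoost c ⁻¹' D) (X ∘ galileanBoost c) (T ∘ galileanBoost c)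
      (U ∘ galileanBoost c) where
  isOpen := h.isOpen.preimage (galileanBoost_contDiff c (n := 0)).continuous
  smoothX := h.smoothX.comp (galileanBoost_contDiff c).contDiffOn fun _ h => h
  smoothT := h.smoothT.comp (galileanBoost_contDiff c).contDiffOn fun _ h => h
  smoothU := h.smoothU.comp (galileanBoost_contDiff c).contDiffOn fun _ h => h
  sym := by
    intro Ω Ω' u v hΩ hΩ' hu hD hv himg
    have hc : Continuous (baseMap 1 c 0 0) := (baseMap_contDiff 1 c 0 0 (n := 0)).continuous
    have hgr : galileanBoost c '' Ω.graphOn u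
        = (baseMap 1 c 0 0 ⁻¹' Ω).graphOn fun p => 1 ^ 2 * u (baseMap 1 c 0 0 p) - c / 6 := by
      ext w
      constructor
      · rintro ⟨_, ⟨p, hp, rfl⟩, rfl⟩
        have e : baseMap 1 c 0 0 (p.1 - c * p.2, p.2) = p := by
          ext <;> simp [baseMap]
        exact ⟨(p.1 - c * p.2, p.2), by simpa [e] using hp, by simp [e, galileanBoost]⟩
      · rintro ⟨p, hp, rfl⟩
        refine ⟨(baseMap 1 c 0 0 p, u (baseMap 1 c 0 0 p)), ⟨_, hp, rfl⟩, ?_⟩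
        simp [galileanBoost, baseMap]
    refine h.sym _ Ω' _ v (hΩ.preimage hc) hΩ' (hu.transform hΩ 1 c 0 0) ?_ hv ?_
    · rw [← hgr]
      exact image_subset_iff.2 hD
    · rw [← hgr, image_image]
      exact himg
  det := by
    intro z hz
    have hz' := h.isOpen.mem_nhds (show galileanBoost c z ∈ D from hz)
    have dX := (h.smoothX.contDiffAt hz').differentiableAt (by simp)
    have dT := (h.smoothT.contDiffAt hz').differentiableAt (by simp)
    have dU := (h.smoothU.contDiffAt hz').differentiableAt (by simp)
    rw [pd_ex_boost dX, pd_ex_boost dT, pd_ex_boost dU, pd_eu_boost dX, pd_eu_boost dT,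
      pd_eu_boost dU, pd_et_boost dX, pd_et_boost dT, pd_et_boost dU]
    convert h.det _ hz using 1
    ring

theorem galileanBoost_neg (c : ℝ) (z : Total) : galileanBoost c (galileanBoost (-c) z) = z := by
  ext <;> simp [galileanBoost, neg_div]

theorem pd_zero_on {E : Type*} [NormedAddCommGroup E] [NormedSpace ℝ E] {D : Set E}
    (hD : IsOpen D) {g : E → ℝ} (hg : ∀ z ∈ D, g z = 0) (e : E) : ∀ z ∈ D, pd e g z = 0 :=
  fun z hz => by
    rw [pd_congr hD (h := fun _ => 0) hg e hz, pd_const]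

theorem op0_zero_on {D : Set Total} (hD : IsOpen D) {T g : Total → ℝ} (hg : ∀ z ∈ D, g z = 0) :
    ∀ z ∈ D, op0 T g z = 0 := fun z hz => by
  simp [op0, pd_zero_on hD hg _ z hz]

theorem op1_zero_on {D : Set Total} (hD : IsOpen D) {T g : Total → ℝ} (hg : ∀ z ∈ D, g z = 0) :
    ∀ z ∈ D, op1 T g z = 0 := fun z hz => by
  simp [op1, pd_zero_on hD hg _ z hz]

section Smooth

variable {D : Set Total} {X T U g : Total → ℝ} {z : Total}

theorem differentiableAt_of_smooth (hD : IsOpen D) (hg : ContDiffOn ℝ ∞ g D) (hz : z ∈ D) :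
    DifferentiableAt ℝ g z :=
  (hg.contDiffAt (hD.mem_nhds hz)).differentiableAt (by simp)

/-- First derivatives of a smooth function composed with the boost, at the preimage of `z`. -/
theorem pd_boost (hD : IsOpen D) (hg : ContDiffOn ℝ ∞ g D) (hz : z ∈ D) (c : ℝ) :
    pd ex (g ∘ galileanBoost c) (galileanBoost (-c) z) = pd ex g z ∧
      pd et (g ∘ galileanBoost c) (galileanBoost (-c) z) = pd et g z - c * pd ex g z ∧
      pd eu (g ∘ galileanBoost c) (galileanBoost (-c) z) = pd eu g z := by
  have hd : DifferentiableAt ℝ g (galileanBoost c (galileanBoost (-c) z)) := by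
    rw [galileanBoost_neg]
    exact differentiableAt_of_smooth hD hg hz
  rw [pd_ex_boost hd, pd_et_boost hd, pd_eu_boost hd, galileanBoost_neg]
  exact ⟨rfl, rfl, rfl⟩

theorem mem_preimage_boost (hz : z ∈ D) (c : ℝ) :
    galileanBoost (-c) z ∈ galileanBoost c ⁻¹' D := by
  rwa [mem_preimage, galileanBoost_neg]

end Smooth

/-! ### The new independent variables do not involve `u`. -/

namespace IsPointSymmetry

variable {D : Set Total} {X T U : Total → ℝ} {z : Total}

/-- Only the square of the second-order terms contributes `q ^ 2` to the determining equation. Its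
coefficient is `T_t ^ 2 * op1 T X` times `T_t` times the Jacobian determinant, up to the factor
`-3`. -/
theorem et_mul_op1_eq_zero (h : IsPointSymmetry D X T U) (hz : z ∈ D) :
    pd et T z * op1 T X z = 0 := by
  by_contra hne
  obtain ⟨ht, h1⟩ := mul_ne_zero_iff.1 hne
  -- This slope makes `lam1 T X z p = 1`, so the pulled-back identity is available.
  set p := (1 - op0 T X z) / op1 T X z with hp
  have hJ : lam1 T X z p ≠ 0 := by
    rw [lam1, hp, div_mul_cancel₀ _ h1]
    norm_num
  have k0 := h.jet_identity hz p 0 hJ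
  have k1 := h.jet_identity hz p 1 hJ
  have k2 := h.jet_identity hz p (-1) hJ
  have hdet : op1 T U z * op0 T X z - op0 T U z * op1 T X z = pd et T z *
      (pd ex X z * (pd et T z * pd eu U z - pd eu T z * pd et U z)
      - pd et X z * (pd ex T z * pd eu U z - pd eu T z * pd ex U z)
      + pd eu X z * (pd ex T z * pd et U z - pd et T z * pd ex U z)) := by
    simp only [op0, op1]
    ring
  have hd := mul_ne_zero ht (h.det z hz)
  rw [← hdet] at hd
  have : pd et T z ^ 2 * op1 T X z
      * (op1 T U z * op0 T X z - op0 T U z * op1 T X z) = 0 := by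
    simp only [lam1, lam2, lam3] at k0 k1 k2
    -- The second difference in `q` over `-1, 0, 1` isolates the coefficient of `q ^ 2`.
    linear_combination (-1 / 6) * (k1 + k2 - 2 * k0)
  exact mul_ne_zero (mul_ne_zero (pow_ne_zero 2 ht) h1) hd this

/-- Boosting makes `et_mul_op1_eq_zero` a quadratic polynomial in `c` that vanishes identically. If
`T_x` and `T_t` are not both zero, its coefficients force `X_u` and `T_u` to be proportional to `T_u
X_t`, `T_u X_x` in a way the determinant excludes unless both vanish. -/
theorem projectable_or (h : IsPointSymmetry D X T U) (hz : z ∈ D) :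
    (pd eu X z = 0 ∧ pd eu T z = 0) ∨ (pd et T z = 0 ∧ pd ex T z = 0) := by
  have hc : ∀ c : ℝ, (pd et T z - c * pd ex T z) * ((pd et T z - c * pd ex T z) * pd eu X z
      - pd eu T z * (pd et X z - c * pd ex X z)) = 0 := fun c => by
    have := (h.boost c).et_mul_op1_eq_zero (mem_preimage_boost hz c)
    obtain ⟨-, t2, t3⟩ := pd_boost h.isOpen h.smoothT hz c
    obtain ⟨-, x2, x3⟩ := pd_boost h.isOpen h.smoothX hz c
    rwa [op1, t2, t3, x2, x3] at this
  by_cases hT : pd et T z = 0 ∧ pd ex T z = 0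
  · exact Or.inr hT
  left
  have c0 := hc 0
  have c1 := hc 1
  have c2 := hc (-1)
  have k0 : pd et T z * (pd et T z * pd eu X z - pd eu T z * pd et X z) = 0 := by
    linear_combination c0
  have k1 : pd et T z * (pd ex T z * pd eu X z - pd eu T z * pd ex X z)
      + pd ex T z * (pd et T z * pd eu X z - pd eu T z * pd et X z) = 0 := by
    linear_combination (c2 - c1) / 2
  have k2 : pd ex T z * (pd ex T z * pd eu X z - pd eu T z * pd ex X z) = 0 := by
    linear_combination (c2 + c1) / 2 - c0
  have hB : pd et T z * pd eu X z - pd eu T z * pd et X z = 0 ∧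
      pd ex T z * pd eu X z - pd eu T z * pd ex X z = 0 := by
    by_cases ht : pd et T z = 0
    · have hx : pd ex T z ≠ 0 := fun hx => hT ⟨ht, hx⟩
      have b1 := (mul_eq_zero.1 k2).resolve_left hx
      rw [ht, zero_mul, zero_add] at k1
      have b0 := (mul_eq_zero.1 k1).resolve_left hx
      exact ⟨by rw [ht]; exact b0, b1⟩
    · have b0 := (mul_eq_zero.1 k0).resolve_left ht
      rw [b0, mul_zero, add_zero] at k1
      exact ⟨b0, (mul_eq_zero.1 k1).resolve_left ht⟩
  obtain ⟨b0, b1⟩ := hB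
  have hTu : pd eu T z = 0 := by
    refine (mul_eq_zero.1 (?_ : pd eu T z * _ = 0)).resolve_right (h.det z hz)
    linear_combination (-(pd et T z * pd eu U z - pd eu T z * pd et U z)) * b1
      + (pd ex T z * pd eu U z - pd eu T z * pd ex U z) * b0
  rw [hTu, zero_mul, sub_zero] at b0 b1
  refine ⟨?_, hTu⟩
  by_contra hne
  exact hT ⟨(mul_eq_zero.1 b0).resolve_right hne, (mul_eq_zero.1 b1).resolve_right hne⟩

/-- If the new time depends on `u` only, each `lam` brings out exactly one factor `p` at `q = 0`.
All terms are then odd in `p` except `(X_x U_t - X_t U_x) J ^ 4`, which must vanish; but `X_x U_t -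
X_t U_x` is a factor of the determinant. -/
theorem et_eq_zero_of_hodograph (h : IsPointSymmetry D X T U) (ht : ∀ z ∈ D, pd et T z = 0)
    (hx : ∀ z ∈ D, pd ex T z = 0) (hz : z ∈ D) : pd et X z = 0 := by
  by_contra hne
  have hdet := h.det z hz
  rw [ht z hz, hx z hz] at hdet
  have hTu : pd eu T z ≠ 0 := fun hTu => hdet (by rw [hTu]; ring)
  have z0 : ∀ g : Total → ℝ, ∀ z ∈ D, op0 T g z = 0 := fun g z hz => by
    simp [op0, ht z hz, hx z hz]
  have z10 : ∀ g : Total → ℝ, ∀ z ∈ D, op1 T (op0 T g) z = 0 := fun g =>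
    op1_zero_on h.isOpen (z0 g)
  have l1 : ∀ g p, lam1 T g z p = p * op1 T g z := fun g p => by
    simp [lam1, z0 g z hz]
  have l2 : ∀ g p, lam2 T g z p 0 = p ^ 2 * op1 T (op1 T g) z := fun g p => by
    simp [lam2, z0 _ z hz, z10 _ z hz]
  have l3 : ∀ g p, lam3 T g z p 0 = p ^ 3 * op1 T (op1 T (op1 T g)) z := fun g p => by
    simp [lam3, z0 _ z hz, z10 _ z hz, op1_zero_on h.isOpen (z10 g) z hz, ht z hz]
  have hY : op1 T X z ≠ 0 := by
    simp [op1, ht z hz, hTu, hne]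
  have k1 := h.jet_identity hz 1 0 (by simpa [l1] using hY)
  have k2 := h.jet_identity hz (-1) 0 (by simpa [l1] using hY)
  simp only [l1, l2, l3] at k1 k2
  have : (pd ex X z * pd et U z - pd et X z * pd ex U z) * op1 T X z ^ 4 = 0 := by
    linear_combination (k1 + k2) / 2
  have := (mul_eq_zero.1 this).resolve_right (pow_ne_zero 4 hY)
  exact hdet (by linear_combination (-pd eu T z) * this)

/-- The new independent variables depend on the old independent variables only. -/
theorem projectable (h : IsPointSymmetry D X T U) (hz : z ∈ D) :
    pd eu X z = 0 ∧ pd eu T z = 0 := by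
  by_contra hne
  have cX := (pd_smooth h.isOpen h.smoothX eu).continuousOn
  have cT := (pd_smooth h.isOpen h.smoothT eu).continuousOn
  -- An open set is needed, since the hodograph case differentiates the relations `T_t = T_x = 0`.
  set D' := D ∩ pd eu X ⁻¹' {0}ᶜ ∪ D ∩ pd eu T ⁻¹' {0}ᶜ with hD'
  have ho : IsOpen D' :=
    (cX.isOpen_inter_preimage h.isOpen isOpen_compl_singleton).union
      (cT.isOpen_inter_preimage h.isOpen isOpen_compl_singleton)
  have hsub : D' ⊆ D := union_subset inter_subset_left inter_subset_left
  have hzD' : z ∈ D' := by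
    by_contra hz'
    apply hne
    simp only [hD', mem_union, mem_inter_iff, hz, true_and, mem_preimage, mem_compl_iff,
      mem_singleton_iff, not_or, not_not] at hz'
    exact hz'
  have h' := h.mono ho hsub
  have hT : ∀ w ∈ D', pd et T w = 0 ∧ pd ex T w = 0 := fun w hw => by
    refine (h.projectable_or (hsub hw)).resolve_left fun hw' => ?_
    rcases hw with hw | hw
    · exact hw.2 hw'.1
    · exact hw.2 hw'.2
  -- Both hypotheses of the hodograph case survive boosts, so `X_t - c X_x = 0` for every `c`. Hence
  -- `X_x = X_t = 0`, contradicting the determinant.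
  have hb : ∀ c : ℝ, pd et X z - c * pd ex X z = 0 := fun c => by
    obtain ⟨-, x2, -⟩ := pd_boost h'.isOpen h'.smoothX hzD' c
    rw [← x2]
    have hd : ∀ w ∈ galileanBoost c ⁻¹' D', DifferentiableAt ℝ T (galileanBoost c w) :=
      fun w hw => differentiableAt_of_smooth ho h'.smoothT hw
    refine (h'.boost c).et_eq_zero_of_hodograph ?_ ?_ (mem_preimage_boost hzD' c)
    · intro w hw
      rw [pd_et_boost (hd w hw), (hT _ hw).1, (hT _ hw).2, mul_zero, sub_zero]
    · intro w hw
      rw [pd_ex_boost (hd w hw), (hT _ hw).2]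
  have b0 := hb 0
  have b1 := hb 1
  have hdet := h.det z hz
  rw [(hT z hzD').1, (hT z hzD').2] at hdet
  apply hdet
  linear_combination (pd eu T z * pd et U z) * (b1 - b0) + pd eu T z * pd ex U z * b0

end IsPointSymmetry

/-! ### Calculus of functions independent of `u`. -/

/-- Smooth functions on `D` whose derivative with respect to `u` vanishes. -/
structure IsBasic (D : Set Total) (g : Total → ℝ) : Prop where
  smooth : ContDiffOn ℝ ∞ g D
  eu_eq_zero : ∀ z ∈ D, pd eu g z = 0

namespace IsBasic

variable {D : Set Total} {g h T : Total → ℝ} {z : Total}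

theorem add (hD : IsOpen D) (hg : IsBasic D g) (hh : IsBasic D h) :
    IsBasic D (fun z => g z + h z) where
  smooth := hg.smooth.add hh.smooth
  eu_eq_zero := fun z hz => by
    rw [pd_add (differentiableAt_of_smooth hD hg.smooth hz)
      (differentiableAt_of_smooth hD hh.smooth hz), hg.eu_eq_zero z hz, hh.eu_eq_zero z hz,
      add_zero]

theorem sub (hD : IsOpen D) (hg : IsBasic D g) (hh : IsBasic D h) :
    IsBasic D (fun z => g z - h z) where
  smooth := hg.smooth.sub hh.smooth
  eu_eq_zero := fun z hz => by
    rw [pd_sub (differentiableAt_of_smooth hD hg.smooth hz)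
      (differentiableAt_of_smooth hD hh.smooth hz), hg.eu_eq_zero z hz, hh.eu_eq_zero z hz,
      sub_zero]

theorem mul (hD : IsOpen D) (hg : IsBasic D g) (hh : IsBasic D h) :
    IsBasic D (fun z => g z * h z) where
  smooth := hg.smooth.mul hh.smooth
  eu_eq_zero := fun z hz => by
    rw [pd_mul (differentiableAt_of_smooth hD hg.smooth hz)
      (differentiableAt_of_smooth hD hh.smooth hz), hg.eu_eq_zero z hz, hh.eu_eq_zero z hz]
    ring

theorem const (k : ℝ) : IsBasic D (fun _ => k) where
  smooth := contDiffOn_const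
  eu_eq_zero := fun _ _ => pd_const

theorem congr (hD : IsOpen D) (hg : IsBasic D g) (hh : EqOn h g D) : IsBasic D h where
  smooth := hg.smooth.congr hh
  eu_eq_zero := fun z hz => by rw [pd_congr hD hh eu hz, hg.eu_eq_zero z hz]

theorem pd (hD : IsOpen D) (hg : IsBasic D g) (e : Total) : IsBasic D (pd e g) where
  smooth := pd_smooth hD hg.smooth e
  eu_eq_zero := fun z hz => by
    rw [pd_comm hD hg.smooth _ _ hz, pd_zero_on hD hg.eu_eq_zero e z hz]

theorem op0 (hD : IsOpen D) (hT : IsBasic D T) (hg : IsBasic D g) : IsBasic D (op0 T g) :=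
  ((hT.pd hD et).mul hD (hg.pd hD ex)).sub hD ((hT.pd hD ex).mul hD (hg.pd hD et))

theorem eu_mul (hD : IsOpen D) (hg : IsBasic D g) (hh : ContDiffOn ℝ ∞ h D) (hz : z ∈ D) :
    KdV.pd eu (fun z => g z * h z) z = g z * KdV.pd eu h z := by
  rw [pd_mul (differentiableAt_of_smooth hD hg.smooth hz) (differentiableAt_of_smooth hD hh hz),
    hg.eu_eq_zero z hz, zero_mul, add_zero]

theorem eu_op0 (hD : IsOpen D) (hT : IsBasic D T) (hg : ContDiffOn ℝ ∞ g D) (hz : z ∈ D) :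
    KdV.pd eu (KdV.op0 T g) z = KdV.op0 T (KdV.pd eu g) z := by
  have sx := pd_smooth hD hg ex
  have st := pd_smooth hD hg et
  have d1 : DifferentiableAt ℝ (fun z => KdV.pd et T z * KdV.pd ex g z) z :=
    differentiableAt_of_smooth hD ((hT.pd hD et).smooth.mul sx) hz
  have d2 : DifferentiableAt ℝ (fun z => KdV.pd ex T z * KdV.pd et g z) z :=
    differentiableAt_of_smooth hD ((hT.pd hD ex).smooth.mul st) hz
  change KdV.pd eu (fun z => KdV.pd et T z * KdV.pd ex g z - KdV.pd ex T z * KdV.pd et g z) z = _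
  rw [pd_sub d1 d2, (hT.pd hD et).eu_mul hD sx hz, (hT.pd hD ex).eu_mul hD st hz,
    pd_comm hD hg eu ex hz, pd_comm hD hg eu et hz, KdV.op0]

theorem op1_eq (hT : IsBasic D T) (hz : z ∈ D) : op1 T g z = KdV.pd et T z * KdV.pd eu g z := by
  rw [op1, hT.eu_eq_zero z hz, zero_mul, sub_zero]

theorem op1_eq_zero (hT : IsBasic D T) (hg : IsBasic D g) : ∀ z ∈ D, op1 T g z = 0 :=
  fun z hz => by rw [hT.op1_eq hz, hg.eu_eq_zero z hz, mul_zero]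

/-- `op1` kills functions without `u`, so nothing depends on the jet variables `p` and `q`. -/
theorem lam_eq (hD : IsOpen D) (hT : IsBasic D T) (hg : IsBasic D g) (hz : z ∈ D) (p q : ℝ) :
    lam1 T g z p = KdV.op0 T g z ∧ lam2 T g z p q = KdV.op0 T (KdV.op0 T g) z ∧
      lam3 T g z p q = KdV.op0 T (KdV.op0 T (KdV.op0 T g)) z := by
  have b0 := hT.op0 hD hg
  have b00 := hT.op0 hD b0
  have z1 := hT.op1_eq_zero hg
  have z10 := hT.op1_eq_zero b0
  have z01 := op0_zero_on (T := T) hD z1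
  have z11 := op1_zero_on (T := T) hD z1
  have zm : ∀ z ∈ D, (fun z => KdV.pd et T z * op1 T g z) z = 0 := fun z hz => by
    simp [z1 z hz]
  refine ⟨?_, ?_, ?_⟩
  · simp [lam1, z1 z hz]
  · simp [lam2, z1 z hz, z10 z hz, z01 z hz, z11 z hz]
  · simp [lam3, z1 z hz, z10 z hz, z01 z hz, z11 z hz, hT.op1_eq_zero b00 z hz,
      op0_zero_on (T := T) hD z10 z hz, op1_zero_on (T := T) hD z10 z hz,
      op0_zero_on (T := T) hD z01 z hz, op1_zero_on (T := T) hD z01 z hz,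
      op0_zero_on (T := T) hD z11 z hz, op1_zero_on (T := T) hD z11 z hz,
      op0_zero_on (T := T) hD zm z hz, op1_zero_on (T := T) hD zm z hz]

/-- Differentiation with respect to `u` of a relation with basic coefficients. -/
theorem eu_relation (hD : IsOpen D) {m k₁ k₂ U : Total → ℝ} (hm : IsBasic D m) (h₁ : IsBasic D k₁)
    (h₂ : IsBasic D k₂) (hU : ContDiffOn ℝ ∞ U D)
    (hrel : ∀ z ∈ D, m z + k₁ z * U z - k₂ z * z.2 = 0) (hz : z ∈ D) :
    k₁ z * KdV.pd eu U z = k₂ z := by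
  have hs : ContDiffOn ℝ ∞ (fun z : Total => z.2) D := contDiffOn_snd
  have hsu : KdV.pd eu (fun z : Total => z.2) z = 1 := by
    simp [KdV.pd, eu, fderiv_snd]
  have d0 := differentiableAt_of_smooth hD hm.smooth hz
  have d1 : DifferentiableAt ℝ (fun z => k₁ z * U z) z :=
    differentiableAt_of_smooth hD (h₁.smooth.mul hU) hz
  have d2 : DifferentiableAt ℝ (fun z => k₂ z * z.2) z :=
    differentiableAt_of_smooth hD (h₂.smooth.mul hs) hz
  have key := pd_zero_on hD hrel eu z hz
  rw [pd_sub (d0.fun_add d1) d2, pd_add d0 d1, hm.eu_eq_zero z hz, h₁.eu_mul hD hU hz,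
    h₂.eu_mul hD hs hz, hsu] at key
  linear_combination key

end IsBasic

theorem pd_eq_coordinates (e : Total) (g : Total → ℝ) (z : Total) :
    pd e g z = e.1.1 * pd ex g z + e.1.2 * pd et g z + e.2 * pd eu g z := by
  have : e = e.1.1 • ex + e.1.2 • et + e.2 • eu := by
    ext <;> simp [ex, et, eu]
  conv_lhs => rw [this]
  simp only [pd, map_add, map_smul, smul_eq_mul]

/-! ### Solving the determining equations. -/

namespace IsPointSymmetry

variable {D : Set Total} {X T U : Total → ℝ} {z : Total}

theorem basicX (h : IsPointSymmetry D X T U) : IsBasic D X :=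
  ⟨h.smoothX, fun _ hz => (h.projectable hz).1⟩

theorem basicT (h : IsPointSymmetry D X T U) : IsBasic D T :=
  ⟨h.smoothT, fun _ hz => (h.projectable hz).2⟩

theorem jacobian_mul_ne_zero (h : IsPointSymmetry D X T U) (hz : z ∈ D) :
    op0 T X z * pd eu U z ≠ 0 := by
  have := h.det z hz
  rw [(h.projectable hz).1, (h.projectable hz).2] at this
  intro h0
  apply this
  rw [op0] at h0
  linear_combination h0

theorem jacobian_ne_zero (h : IsPointSymmetry D X T U) (hz : z ∈ D) : op0 T X z ≠ 0 :=
  (mul_ne_zero_iff.1 (h.jacobian_mul_ne_zero hz)).1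

theorem eu_ne_zero (h : IsPointSymmetry D X T U) (hz : z ∈ D) : pd eu U z ≠ 0 :=
  (mul_ne_zero_iff.1 (h.jacobian_mul_ne_zero hz)).2

/-- The determining equation once the new independent variables are known not to involve `u`. -/
theorem projectable_identity (h : IsPointSymmetry D X T U) (hz : z ∈ D) (p q : ℝ) :
    (pd ex X z * pd et U z - pd et X z * pd ex U z - p * (pd et X z * pd eu U z)) * op0 T X z ^ 4
      + 6 * U z * lam1 T U z p * op0 T X z ^ 4
      + op0 T X z * (lam3 T U z p q * op0 T X z - lam1 T U z p * op0 T (op0 T (op0 T X)) z)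
      - 3 * (lam2 T U z p q * op0 T X z - lam1 T U z p * op0 T (op0 T X) z)
        * op0 T (op0 T X) z = 0 := by
  obtain ⟨X1, X2, X3⟩ := h.basicT.lam_eq h.isOpen h.basicX hz p q
  have key := h.jet_identity hz p q (by rw [X1]; exact h.jacobian_ne_zero hz)
  rw [X1, X2, X3, (h.projectable hz).1] at key
  linear_combination key

theorem et_pow_mul_eu_eu (h : IsPointSymmetry D X T U) (hz : z ∈ D) :
    pd et T z ^ 3 * pd eu (pd eu U) z = 0 := by
  have hD := h.isOpen
  have bT := h.basicT
  have bt := bT.pd hD et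
  have sW := pd_smooth hD h.smoothU eu
  have e1 : EqOn (op1 T U) (fun z => pd et T z * pd eu U z) D := fun z hz => bT.op1_eq hz
  have e2 : op1 T (op1 T U) z = pd et T z * (pd et T z * pd eu (pd eu U) z) := by
    rw [op1_congr hD e1 hz, bT.op1_eq hz, bt.eu_mul hD sW hz]
  have e3 : op1 T (fun z => pd et T z * op1 T U z) z
      = pd et T z * (pd et T z * (pd et T z * pd eu (pd eu U) z)) := by
    have s1 := op1_smooth hD h.smoothT h.smoothU
    rw [bT.op1_eq hz, bt.eu_mul hD s1 hz, pd_congr hD e1 eu hz, bt.eu_mul hD sW hz]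
  have k00 := h.projectable_identity hz 0 0
  have k01 := h.projectable_identity hz 0 1
  have k10 := h.projectable_identity hz 1 0
  have k11 := h.projectable_identity hz 1 1
  simp only [lam1, lam2, lam3, e2, e3] at k00 k01 k10 k11
  refine (mul_eq_zero.1 (?_ : op0 T X z ^ 2 * _ = 0)).resolve_left
    (pow_ne_zero 2 (h.jacobian_ne_zero hz))
  -- The mixed difference isolates the coefficient of `p q`, which comes from the third-order term
  -- of `U` alone: two copies of `T_t ^ 3 U_uu` from `2 * p` and one from the derivative of `T_t *
  -- op1 T U`.
  linear_combination (k11 - k10 - k01 + k00) / 3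

/-- Otherwise boosting gives `T_t - c T_x = 0` for all `c`, so the gradient of `T` vanishes and with
it the Jacobian. -/
theorem eu_eu_eq_zero (h : IsPointSymmetry D X T U) (hz : z ∈ D) : pd eu (pd eu U) z = 0 := by
  by_contra hne
  have hc : ∀ c : ℝ, pd et T z - c * pd ex T z = 0 := fun c => by
    have k := (h.boost c).et_pow_mul_eu_eu (mem_preimage_boost hz c)
    have e : EqOn (pd eu (U ∘ galileanBoost c)) (pd eu U ∘ galileanBoost c)
        (galileanBoost c ⁻¹' D) := fun w hw =>
      pd_eu_boost (differentiableAt_of_smooth h.isOpen h.smoothU hw)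
    rw [pd_congr (h.boost c).isOpen e eu (mem_preimage_boost hz c),
      (pd_boost h.isOpen h.smoothT hz c).2.1,
      (pd_boost h.isOpen (pd_smooth h.isOpen h.smoothU eu) hz c).2.2] at k
    exact pow_eq_zero_iff (three_ne_zero) |>.1 ((mul_eq_zero.1 k).resolve_right hne)
  have c0 := hc 0
  have c1 := hc 1
  apply h.jacobian_ne_zero hz
  rw [op0]
  linear_combination pd ex X z * c0 + pd et X z * (c1 - c0)

theorem basicW (h : IsPointSymmetry D X T U) : IsBasic D (pd eu U) :=
  ⟨pd_smooth h.isOpen h.smoothU eu, fun _ hz => h.eu_eu_eq_zero hz⟩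

/-- The coefficient of `p` at `q = 0` has the form `m + k₁ U - k₂ u` with `m`, `k₁`, `k₂` free of
`u`. One differentiation in `u` discards the complicated `m`. -/
theorem et_mul_scaling_relation (h : IsPointSymmetry D X T U) (hz : z ∈ D) :
    pd et T z * (op0 T X z ^ 2 * pd eu U z - pd et T z ^ 2) = 0 := by
  have hD := h.isOpen
  have bT := h.basicT
  have bX := h.basicX
  have bW := h.basicW
  have bt := bT.pd hD et
  have s0 := op0_smooth hD h.smoothT h.smoothU
  have bK : IsBasic D (op1 T U) := (bt.mul hD bW).congr hD fun z hz => bT.op1_eq hz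
  have b10 : IsBasic D (op1 T (op0 T U)) :=
    (bt.mul hD (bT.op0 hD bW)).congr hD fun z hz => by
      simp only [bT.op1_eq hz, bT.eu_op0 hD h.smoothU hz]
  have b100 : IsBasic D (op1 T (op0 T (op0 T U))) :=
    (bt.mul hD (bT.op0 hD (bT.op0 hD bW))).congr hD fun z hz => by
      simp only [bT.op1_eq hz, bT.eu_op0 hD s0 hz]
      rw [op0_congr hD (fun z hz => bT.eu_op0 hD h.smoothU hz) hz]
  have b01 := bT.op0 hD bK
  have b010 := bT.op0 hD b10
  have b001 := bT.op0 hD b01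
  have bJ := bT.op0 hD bX
  have bJ1 := bT.op0 hD bJ
  have bJ2 := bT.op0 hD bJ1
  have bJJ := bJ.mul hD bJ
  have bJ4 := bJJ.mul hD bJJ
  have bS := (b100.add hD b010).add hD b001
  have bS2 := b10.add hD b01
  have bm := (((((IsBasic.const 0).sub hD ((bX.pd hD et).mul hD (bW.mul hD bJ4))).add hD
    (bJJ.mul hD bS)).sub hD (bJ.mul hD (bK.mul hD bJ2))).sub hD
    (((IsBasic.const 3).mul hD ((bS2.mul hD bJ).sub hD (bK.mul hD bJ1))).mul hD bJ1))
  have bk1 := ((IsBasic.const 6).mul hD bK).mul hD bJ4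
  have bk2 := ((IsBasic.const 6).mul hD bK).mul hD (bJJ.mul hD (bt.mul hD bt))
  -- Since `U_uu = 0`, the terms in `p ^ 2` and `p ^ 3` vanish, and `k1 - k0` is exactly the
  -- coefficient of `p`.
  have hrel := IsBasic.eu_relation hD bm bk1 bk2 h.smoothU (fun w hw => by
    have k0 := h.projectable_identity hw 0 0
    have k1 := h.projectable_identity hw 1 0
    simp only [lam1, lam2, lam3, bT.op1_eq_zero bK w hw, bT.op1_eq_zero b10 w hw,
      bT.op1_eq_zero b01 w hw, op0_zero_on (T := T) hD (bT.op1_eq_zero bK) w hw,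
      op1_zero_on (T := T) hD (bT.op1_eq_zero bK) w hw] at k0 k1
    linear_combination k1 - k0) hz
  simp only [bT.op1_eq hz] at hrel
  have hne := mul_ne_zero (h.eu_ne_zero hz) (pow_ne_zero 2 (h.jacobian_ne_zero hz))
  refine (mul_eq_zero.1 (?_ : pd eu U z * op0 T X z ^ 2
    * (pd et T z * (op0 T X z ^ 2 * pd eu U z - pd et T z ^ 2)) = 0)).resolve_left hne
  linear_combination hrel / 6

/-- The new time depends on the old time only. -/
theorem ex_time_eq_zero (h : IsPointSymmetry D X T U) (hz : z ∈ D) : pd ex T z = 0 := by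
  have hc : ∀ c : ℝ, (pd et T z - c * pd ex T z)
      * (op0 T X z ^ 2 * pd eu U z - (pd et T z - c * pd ex T z) ^ 2) = 0 := fun c => by
    have k := (h.boost c).et_mul_scaling_relation (mem_preimage_boost hz c)
    obtain ⟨t1, t2, -⟩ := pd_boost h.isOpen h.smoothT hz c
    obtain ⟨x1, x2, -⟩ := pd_boost h.isOpen h.smoothX hz c
    obtain ⟨-, -, u3⟩ := pd_boost h.isOpen h.smoothU hz c
    rw [op0, t1, t2, x1, x2, u3] at k
    rw [op0]
    linear_combination k
  have h0 := hc 0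
  have h1 := hc 1
  have h2 := hc 2
  have h3 := hc (-1)
  refine pow_eq_zero_iff (three_ne_zero) |>.1 ?_
  -- The Jacobian and `U_u` are boost-invariant, so the relation is cubic in `c` with leading
  -- coefficient `T_x ^ 3`; its third difference is `6 T_x ^ 3`.
  linear_combination (h2 - 3 * h1 + 3 * h0 - h3) / 6

theorem op0_eq (h : IsPointSymmetry D X T U) (hz : z ∈ D) (g : Total → ℝ) :
    op0 T g z = pd et T z * pd ex g z := by
  rw [op0, h.ex_time_eq_zero hz, zero_mul, sub_zero]

theorem et_time_ne_zero (h : IsPointSymmetry D X T U) (hz : z ∈ D) : pd et T z ≠ 0 :=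
  fun h0 => h.jacobian_ne_zero hz (by rw [h.op0_eq hz, h0, zero_mul])

theorem ex_space_ne_zero (h : IsPointSymmetry D X T U) (hz : z ∈ D) : pd ex X z ≠ 0 :=
  fun h0 => h.jacobian_ne_zero hz (by rw [h.op0_eq hz, h0, mul_zero])

theorem eu_mul_sq (h : IsPointSymmetry D X T U) (hz : z ∈ D) :
    pd eu U z * (pd ex X z * pd ex X z) = 1 := by
  have k := (mul_eq_zero.1 (h.et_mul_scaling_relation hz)).resolve_left (h.et_time_ne_zero hz)
  rw [h.op0_eq hz] at k
  refine mul_left_cancel₀ (pow_ne_zero 2 (h.et_time_ne_zero hz)) ?_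
  linear_combination k

/-- Differentiating `U_u X_x ^ 2 = 1`. -/
theorem pd_eu_mul_sq (h : IsPointSymmetry D X T U) (hz : z ∈ D) (e : Total) :
    pd eu U z * (2 * pd ex X z * pd e (pd ex X) z)
      + pd e (pd eu U) z * (pd ex X z * pd ex X z) = 0 := by
  have hD := h.isOpen
  have dx := differentiableAt_of_smooth hD (pd_smooth hD h.smoothX ex) hz
  have dw := differentiableAt_of_smooth hD (pd_smooth hD h.smoothU eu) hz
  have e1 : EqOn (fun z => pd eu U z * (pd ex X z * pd ex X z)) (fun _ => 1) D :=
    fun z hz => h.eu_mul_sq hz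
  have k := pd_congr hD e1 e hz
  rw [pd_const, pd_mul dw (dx.fun_mul dx), pd_mul dx dx] at k
  linear_combination k

theorem ex_et_mul (h : IsPointSymmetry D X T U) {g : Total → ℝ} (hg : ContDiffOn ℝ ∞ g D)
    (hz : z ∈ D) : pd ex (fun z => pd et T z * g z) z = pd et T z * pd ex g z := by
  have hD := h.isOpen
  rw [pd_mul (differentiableAt_of_smooth hD (pd_smooth hD h.smoothT et) hz)
    (differentiableAt_of_smooth hD hg hz), pd_comm hD h.smoothT ex et hz,
    pd_zero_on hD (fun z hz => h.ex_time_eq_zero hz) et z hz, zero_mul, add_zero]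

theorem op0_op0_eq (h : IsPointSymmetry D X T U) {g : Total → ℝ} (hg : ContDiffOn ℝ ∞ g D)
    (hz : z ∈ D) : op0 T (op0 T g) z = pd et T z * (pd et T z * pd ex (pd ex g) z) := by
  have hD := h.isOpen
  rw [op0_congr hD (fun z hz => h.op0_eq hz g) hz, h.op0_eq hz,
    h.ex_et_mul (pd_smooth hD hg ex) hz]

theorem op1_op0_eq (h : IsPointSymmetry D X T U) (hz : z ∈ D) :
    op1 T (op0 T U) z = pd et T z * (pd et T z * pd ex (pd eu U) z) := by
  rw [h.basicT.op1_eq hz, h.basicT.eu_op0 h.isOpen h.smoothU hz, h.op0_eq hz]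

theorem op0_op1_eq (h : IsPointSymmetry D X T U) (hz : z ∈ D) :
    op0 T (op1 T U) z = pd et T z * (pd et T z * pd ex (pd eu U) z) := by
  have hD := h.isOpen
  rw [op0_congr hD (fun z hz => h.basicT.op1_eq hz) hz, h.op0_eq hz,
    h.ex_et_mul (pd_smooth hD h.smoothU eu) hz]

/-- The coefficient of `q` at `p = 0` gives one linear relation between `X_xx` and `U_xu`;
differentiating `U_u X_x ^ 2 = 1` in `x` gives an independent one. -/
theorem second_derivatives_space (h : IsPointSymmetry D X T U) (hz : z ∈ D) :
    pd ex (pd ex X) z = 0 ∧ pd ex (pd eu U) z = 0 := by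
  have hD := h.isOpen
  have e3 : op0 T (fun z => pd et T z * op1 T U z) z
      = pd et T z * (pd et T z * (pd et T z * pd ex (pd eu U) z)) := by
    rw [h.op0_eq hz, h.ex_et_mul (op1_smooth hD h.smoothT h.smoothU) hz,
      pd_congr hD (fun z hz => h.basicT.op1_eq hz) ex hz, h.ex_et_mul (pd_smooth hD h.smoothU eu) hz]
  have k0 := h.projectable_identity hz 0 0
  have k1 := h.projectable_identity hz 0 1
  simp only [lam1, lam2, lam3, e3, h.op1_op0_eq hz, h.op0_op1_eq hz, h.basicT.op1_eq hz,
    h.op0_op0_eq h.smoothX hz, h.op0_eq hz X] at k0 k1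
  have hx := h.ex_space_ne_zero hz
  have ht := h.et_time_ne_zero hz
  have hw := h.eu_ne_zero hz
  have A : pd ex X z * pd ex X z * pd ex (pd eu U) z
      - pd eu U z * pd ex X z * pd ex (pd ex X) z = 0 := by
    refine (mul_eq_zero.1 (?_ : pd et T z ^ 5 * _ = 0)).resolve_left (pow_ne_zero 5 ht)
    linear_combination (k1 - k0) / 3
  have B := h.pd_eu_mul_sq hz ex
  have C : pd ex (pd ex X) z = 0 := by
    refine (mul_eq_zero.1 (?_ : pd eu U z * pd ex X z * _ = 0)).resolve_left (mul_ne_zero hw hx)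
    linear_combination (B - A) / 3
  refine ⟨C, (mul_eq_zero.1 (?_ : pd ex X z * pd ex X z * _ = 0)).resolve_left
    (mul_ne_zero hx hx)⟩
  rw [C] at A
  linear_combination A

/-- The determining equations that remain once second derivatives in `x` and `u` are known. -/
theorem remaining_equations (h : IsPointSymmetry D X T U) (hz : z ∈ D) :
    (pd ex X z * pd et U z - pd et X z * pd ex U z + 6 * U z * pd et T z * pd ex U z)
        * pd ex X z ^ 2 * pd et T z ^ 2 + op0 T (op0 T (op0 T U)) z = 0 ∧
      6 * U z * pd et T z * pd ex X z ^ 2 - pd et X z * pd ex X z ^ 2 - 6 * z.2 * pd et T z = 0 := by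
  have hD := h.isOpen
  have bT := h.basicT
  have zX : ∀ z ∈ D, op0 T (op0 T X) z = 0 := fun z hz => by
    rw [h.op0_op0_eq h.smoothX hz, (h.second_derivatives_space hz).1, mul_zero, mul_zero]
  have z10 : ∀ z ∈ D, op1 T (op0 T U) z = 0 := fun z hz => by
    rw [h.op1_op0_eq hz, (h.second_derivatives_space hz).2, mul_zero, mul_zero]
  have z01 : ∀ z ∈ D, op0 T (op1 T U) z = 0 := fun z hz => by
    rw [h.op0_op1_eq hz, (h.second_derivatives_space hz).2, mul_zero, mul_zero]
  have z11 : ∀ z ∈ D, op1 T (op1 T U) z = 0 :=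
    bT.op1_eq_zero (((bT.pd hD et).mul hD h.basicW).congr hD fun z hz => bT.op1_eq hz)
  have z100 : op1 T (op0 T (op0 T U)) z = 0 := by
    rw [bT.op1_eq hz, bT.eu_op0 hD (op0_smooth hD h.smoothT h.smoothU) hz, op0_zero_on hD ?_ z hz,
      mul_zero]
    intro w hw
    have := z10 w hw
    rw [bT.op1_eq hw] at this
    exact (mul_eq_zero.1 this).resolve_left (h.et_time_ne_zero hw)
  -- At `q = 0` the identity is now affine in `p`: its constant term gives the first equation, its
  -- slope the second.
  have k0 := h.projectable_identity hz 0 0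
  have k1 := h.projectable_identity hz 1 0
  simp only [lam1, lam2, lam3, zX z hz, op0_zero_on (T := T) hD zX z hz, z10 z hz, z01 z hz,
    z11 z hz, z100, op0_zero_on (T := T) hD z10 z hz, op0_zero_on (T := T) hD z01 z hz,
    op1_zero_on (T := T) hD z10 z hz, op1_zero_on (T := T) hD z01 z hz,
    op0_zero_on (T := T) hD z11 z hz, op1_zero_on (T := T) hD z11 z hz,
    bT.op1_eq hz, h.op0_eq hz X, h.op0_eq hz U] at k0 k1
  have hx := h.ex_space_ne_zero hz
  have ht := h.et_time_ne_zero hz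
  have hw := h.eu_ne_zero hz
  refine ⟨?_, ?_⟩
  · refine (mul_eq_zero.1 (?_ : pd et T z ^ 2 * pd ex X z ^ 2 * _ = 0)).resolve_left
      (mul_ne_zero (pow_ne_zero 2 ht) (pow_ne_zero 2 hx))
    linear_combination k0
  · refine (mul_eq_zero.1 (?_ : pd et T z ^ 4 * pd ex X z ^ 2 * pd eu U z * _ = 0)).resolve_left
      (mul_ne_zero (mul_ne_zero (pow_ne_zero 4 ht) (pow_ne_zero 2 hx)) hw)
    linear_combination k1 - k0

/-- The boost with `c = 1` changes `X_t` to `X_t - X_x` and `u` to `u + 1 / 6` in the second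
remaining equation while fixing `U`, `T_t` and `X_x`. Subtracting the two versions leaves `T_t - X_x
^ 3`. -/
theorem et_time_eq (h : IsPointSymmetry D X T U) (hz : z ∈ D) : pd et T z = pd ex X z ^ 3 := by
  have k0 := (h.remaining_equations hz).2
  have k := ((h.boost 1).remaining_equations (mem_preimage_boost hz 1)).2
  obtain ⟨t1, t2, -⟩ := pd_boost h.isOpen h.smoothT hz 1
  obtain ⟨x1, x2, -⟩ := pd_boost h.isOpen h.smoothX hz 1
  rw [t2, x1, x2, Function.comp_apply, galileanBoost_neg, h.ex_time_eq_zero hz] at k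
  have e : (galileanBoost (-1) z).2 = z.2 + 1 / 6 := by
    simp [galileanBoost, neg_div]
  rw [e] at k
  linear_combination k0 - k

theorem value_relation (h : IsPointSymmetry D X T U) (hz : z ∈ D) :
    6 * U z * pd ex X z ^ 3 - pd et X z - 6 * z.2 * pd ex X z = 0 := by
  have k := (h.remaining_equations hz).2
  rw [h.et_time_eq hz] at k
  refine (mul_eq_zero.1 (?_ : pd ex X z ^ 2 * _ = 0)).resolve_left
    (pow_ne_zero 2 (h.ex_space_ne_zero hz))
  linear_combination k

theorem pd_value_relation (h : IsPointSymmetry D X T U) (hz : z ∈ D) (e : Total) :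
    6 * pd e U z * pd ex X z ^ 3 + 18 * U z * pd ex X z ^ 2 * pd e (pd ex X) z
      - pd e (pd et X) z - 6 * (e.2 * pd ex X z + z.2 * pd e (pd ex X) z) = 0 := by
  have hD := h.isOpen
  have dx := differentiableAt_of_smooth hD (pd_smooth hD h.smoothX ex) hz
  have dt := differentiableAt_of_smooth hD (pd_smooth hD h.smoothX et) hz
  have dU := differentiableAt_of_smooth hD h.smoothU hz
  have ds : DifferentiableAt ℝ (fun z : Total => z.2) z := differentiableAt_snd
  have es : pd e (fun z : Total => z.2) z = e.2 := by
    simp [pd, fderiv_snd]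
  have d6 : DifferentiableAt ℝ (fun _ : Total => (6 : ℝ)) z := differentiableAt_const _
  have d1 := dx.fun_mul (dx.fun_mul dx)
  have d2 := dU.fun_mul d1
  have d3 := d6.fun_mul d2
  have d4 := ds.fun_mul dx
  have d5 := d6.fun_mul d4
  have k := pd_zero_on hD (g := fun z => 6 * (U z * (pd ex X z * (pd ex X z * pd ex X z)))
    - pd et X z - 6 * (z.2 * pd ex X z))
    (fun w hw => by linear_combination h.value_relation hw) e z hz
  rw [pd_sub (d3.fun_sub dt) d5, pd_sub d3 dt, pd_mul d6 d2, pd_mul dU d1, pd_mul dx (dx.fun_mul dx),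
    pd_mul dx dx, pd_mul d6 d4, pd_mul ds dx, pd_const, es] at k
  linear_combination k

theorem ex_value_eq (h : IsPointSymmetry D X T U) (hz : z ∈ D) :
    6 * pd ex U z * pd ex X z ^ 3 = pd ex (pd et X) z := by
  have k := h.pd_value_relation hz ex
  rw [(h.second_derivatives_space hz).1, show ex.2 = (0 : ℝ) from rfl] at k
  linear_combination k

/-- As `X_xx = 0`, also `X_txx = 0`, and `ex_value_eq` gives `U_xx = 0`. The first remaining
equation loses its third-order term, and `value_relation` reduces it to this transport equation. -/
theorem et_value_eq (h : IsPointSymmetry D X T U) (hz : z ∈ D) :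
    pd et U z = -6 * z.2 * pd ex U z := by
  have hD := h.isOpen
  have hUxx : ∀ z ∈ D, pd ex (pd ex U) z = 0 := fun z hz => by
    have dx := differentiableAt_of_smooth hD (pd_smooth hD h.smoothX ex) hz
    have dU := differentiableAt_of_smooth hD (pd_smooth hD h.smoothU ex) hz
    have sxt := pd_smooth hD (pd_smooth hD h.smoothX et) ex
    have dxt := differentiableAt_of_smooth hD sxt hz
    have k := pd_zero_on hD (g := fun z => pd ex U z * (pd ex X z * (pd ex X z * pd ex X z))
      - 1 / 6 * pd ex (pd et X) z) (fun w hw => by linear_combination h.ex_value_eq hw / 6) ex z hz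
    have hxtx : pd ex (pd ex (pd et X)) z = 0 := by
      rw [pd_congr hD (fun z hz => pd_comm hD h.smoothX ex et hz) ex hz,
        pd_comm hD (pd_smooth hD h.smoothX ex) ex et hz]
      exact pd_zero_on hD (fun z hz => (h.second_derivatives_space hz).1) et z hz
    have d6 : DifferentiableAt ℝ (fun _ : Total => (1 / 6 : ℝ)) z := differentiableAt_const _
    have d1 := dx.fun_mul (dx.fun_mul dx)
    rw [pd_sub (dU.fun_mul d1) (d6.fun_mul dxt), pd_mul dU d1, pd_mul dx (dx.fun_mul dx),
      pd_mul dx dx, pd_mul d6 dxt, pd_const, hxtx, (h.second_derivatives_space hz).1] at k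
    refine (mul_eq_zero.1 (?_ : _ * pd ex X z ^ 3 = 0)).resolve_right
      (pow_ne_zero 3 (h.ex_space_ne_zero hz))
    linear_combination k
  have k := (h.remaining_equations hz).1
  rw [op0_zero_on hD (fun w hw => by
    rw [h.op0_op0_eq h.smoothU hw, hUxx w hw, mul_zero, mul_zero]) z hz] at k
  have hx := h.ex_space_ne_zero hz
  have ht := h.et_time_ne_zero hz
  have k2 : pd ex X z * pd et U z - pd et X z * pd ex U z
      + 6 * U z * pd et T z * pd ex U z = 0 := by
    refine (mul_eq_zero.1 (?_ : _ * (pd ex X z ^ 2 * pd et T z ^ 2) = 0)).resolve_right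
      (mul_ne_zero (pow_ne_zero 2 hx) (pow_ne_zero 2 ht))
    linear_combination k
  rw [h.et_time_eq hz] at k2
  have k3 := h.value_relation hz
  refine mul_left_cancel₀ hx ?_
  linear_combination k2 - pd ex U z * k3

/-- `U_tu` is computed twice: the transport equation gives `-6 U_x`, while the time derivative of
`U_u X_x ^ 2 = 1` together with `X_tx = 6 U_x X_x ^ 3` gives `-12 U_x`. -/
theorem ex_value_eq_zero (h : IsPointSymmetry D X T U) (hz : z ∈ D) : pd ex U z = 0 := by
  have hD := h.isOpen
  have sUx := pd_smooth hD h.smoothU ex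
  have k1 : pd eu (pd et U) z = -6 * pd ex U z := by
    have ds : DifferentiableAt ℝ (fun z : Total => z.2) z := differentiableAt_snd
    have es : pd eu (fun z : Total => z.2) z = 1 := by
      simp [pd, fderiv_snd, eu]
    have d6 : DifferentiableAt ℝ (fun _ : Total => (-6 : ℝ)) z := differentiableAt_const _
    have k := pd_congr hD (g := pd et U) (h := fun z => -6 * z.2 * pd ex U z)
      (fun z hz => h.et_value_eq hz) eu hz
    rw [pd_mul (d6.fun_mul ds) (differentiableAt_of_smooth hD sUx hz), pd_mul d6 ds, pd_const, es,
      pd_comm hD h.smoothU eu ex hz, (h.second_derivatives_space hz).2] at k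
    linear_combination k
  have k2 := h.pd_eu_mul_sq hz et
  rw [pd_comm hD h.smoothU et eu hz, k1, pd_comm hD h.smoothX et ex hz, ← h.ex_value_eq hz] at k2
  refine (mul_eq_zero.1 (?_ : pd ex X z ^ 2 * _ = 0)).resolve_left
    (pow_ne_zero 2 (h.ex_space_ne_zero hz))
  linear_combination k2 / 6 - 2 * pd ex X z ^ 2 * pd ex U z * h.eu_mul_sq hz

theorem et_value_eq_zero (h : IsPointSymmetry D X T U) (hz : z ∈ D) : pd et U z = 0 := by
  rw [h.et_value_eq hz, h.ex_value_eq_zero hz, mul_zero]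

theorem pd_ex_space_eq_zero (h : IsPointSymmetry D X T U) (hz : z ∈ D) (e : Total) :
    pd e (pd ex X) z = 0 := by
  rw [pd_eq_coordinates, (h.second_derivatives_space hz).1, pd_comm h.isOpen h.smoothX et ex hz,
    ← h.ex_value_eq hz, h.ex_value_eq_zero hz, (h.basicX.pd h.isOpen ex).eu_eq_zero z hz]
  ring

theorem pd_et_space_eq_zero (h : IsPointSymmetry D X T U) (hz : z ∈ D) (e : Total) :
    pd e (pd et X) z = 0 := by
  have k := h.pd_value_relation hz et
  rw [h.et_value_eq_zero hz, h.pd_ex_space_eq_zero hz, show et.2 = (0 : ℝ) from rfl] at k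
  rw [pd_eq_coordinates, ← h.ex_value_eq hz, h.ex_value_eq_zero hz,
    (h.basicX.pd h.isOpen et).eu_eq_zero z hz]
  linear_combination (-e.1.2) * k

end IsPointSymmetry

/-! ### From constant derivatives to the normal form; the finite classification. -/

/-- A smooth function with constant partial derivatives on a connected open set is affine. -/
theorem exists_affine_of_pd_const {D : Set Total} (hD : IsOpen D) (hc : IsConnected D)
    {g : Total → ℝ} (hg : ContDiffOn ℝ ∞ g D) {α β γ : ℝ} (hx : ∀ z ∈ D, pd ex g z = α)
    (ht : ∀ z ∈ D, pd et g z = β) (hu : ∀ z ∈ D, pd eu g z = γ) :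
    ∃ k, ∀ z ∈ D, g z = α * z.1.1 + β * z.1.2 + γ * z.2 + k := by
  obtain ⟨z₀, hz₀⟩ := hc.nonempty
  set L : Total →L[ℝ] ℝ :=
    α • (ContinuousLinearMap.fst ℝ ℝ ℝ).comp (ContinuousLinearMap.fst ℝ Base ℝ)
    + β • (ContinuousLinearMap.snd ℝ ℝ ℝ).comp (ContinuousLinearMap.fst ℝ Base ℝ)
    + γ • ContinuousLinearMap.snd ℝ Base ℝ with hL
  have hLz : ∀ z, L z = α * z.1.1 + β * z.1.2 + γ * z.2 := fun z => by simp [hL]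
  refine ⟨g z₀ - L z₀, fun z hz => ?_⟩
  have key := hD.eqOn_of_fderiv_eq (𝕜 := ℝ) (f := g) (g := fun z => L z + (g z₀ - L z₀))
    hc.isPreconnected (hg.differentiableOn (by simp)) (by fun_prop) (fun w hw => by
      have : HasFDerivAt (fun z => L z + (g z₀ - L z₀)) L w := L.hasFDerivAt.add_const _
      rw [this.fderiv]
      refine ContinuousLinearMap.ext fun e => ?_
      have := pd_eq_coordinates e g w
      rw [hx w hw, ht w hw, hu w hw] at this
      rw [hLz, ← pd, this]
      ring) hz₀ (by ring) hz
  simp only [key, hLz]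

theorem IsPointSymmetry.exists_normalForm {D : Set Total} {X T U : Total → ℝ}
    (h : IsPointSymmetry D X T U) (hc : IsConnected D) :
    ∃ a b c s : ℝ, s ≠ 0 ∧ EqOn (fun z => ((X z, T z), U z)) (normalForm a b c s) D := by
  have hD := h.isOpen
  have const : ∀ g : Total → ℝ, ContDiffOn ℝ ∞ g D → (∀ z ∈ D, ∀ e, pd e g z = 0) →
      ∃ k, ∀ z ∈ D, g z = k := fun g hg h0 => by
    obtain ⟨k, hk⟩ := exists_affine_of_pd_const hD hc hg (fun z hz => h0 z hz ex)
      (fun z hz => h0 z hz et) (fun z hz => h0 z hz eu)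
    exact ⟨k, fun z hz => by rw [hk z hz]; ring⟩
  obtain ⟨s, hs⟩ := const _ (pd_smooth hD h.smoothX ex) fun z hz e => h.pd_ex_space_eq_zero hz e
  obtain ⟨m, hm⟩ := const _ (pd_smooth hD h.smoothX et) fun z hz e => h.pd_et_space_eq_zero hz e
  obtain ⟨z₀, hz₀⟩ := hc.nonempty
  have hs0 : s ≠ 0 := hs z₀ hz₀ ▸ h.ex_space_ne_zero hz₀
  obtain ⟨a, ha⟩ := exists_affine_of_pd_const hD hc h.smoothX hs hm h.basicX.eu_eq_zero
  obtain ⟨b, hb⟩ := exists_affine_of_pd_const hD hc h.smoothT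
    (fun z hz => h.ex_time_eq_zero hz) (β := s ^ 3) (fun z hz => by rw [h.et_time_eq hz, hs z hz])
    h.basicT.eu_eq_zero
  obtain ⟨k, hk⟩ := exists_affine_of_pd_const hD hc h.smoothU
    (fun z hz => h.ex_value_eq_zero hz) (fun z hz => h.et_value_eq_zero hz) (γ := 1 / s ^ 2)
    (fun z hz => by
      have := h.eu_mul_sq hz
      rw [hs z hz] at this
      field_simp
      linear_combination this)
  have hmk : m = 6 * k * s ^ 3 := by
    have := h.value_relation hz₀
    rw [hk z₀ hz₀, hs z₀ hz₀, hm z₀ hz₀] at this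
    field_simp at this
    linear_combination -this
  -- Here `k` is the constant term of `U`, which the normal form writes as `-c / 6`; `hmk` makes the
  -- shear equal to `-c * s ^ 3`.
  refine ⟨a, b, -6 * k, s, hs0, fun z hz => ?_⟩
  simp only [normalForm, ha z hz, hb z hz, hk z hz, hmk]
  ext <;> simp only <;> ring

/-- On an open set a small shift in `x` stays inside. -/
theorem exists_shift_mem {D : Set Total} (hD : IsOpen D) {z : Total} (hz : z ∈ D) :
    ∃ δ : ℝ, 0 < δ ∧ ((z.1.1 + δ, z.1.2), z.2) ∈ D := by
  have hev : ∀ᶠ δ : ℝ in 𝓝 0, ((z.1.1 + δ, z.1.2), z.2) ∈ D := by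
    have hcont : Continuous fun δ : ℝ => (((z.1.1 + δ, z.1.2), z.2) : Total) := by fun_prop
    exact hcont.continuousAt.eventually (hD.mem_nhds (by simpa using hz))
  obtain ⟨δ, h1, h2⟩ := ((hev.filter_mono nhdsWithin_le_nhds).and
    (self_mem_nhdsWithin : Ioi (0 : ℝ) ∈ 𝓝[>] 0)).exists
  exact ⟨δ, h2, h1⟩

/-- Two points of `D` differing only in `x` determine `s`, including its sign. The value coordinate
then gives `c`, and the remaining coordinates give `a` and `b`. -/
theorem normalForm_injective {D : Set Total} (hD : IsOpen D) (hne : D.Nonempty)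
    {a b c s a' b' c' s' : ℝ} (h : EqOn (normalForm a b c s) (normalForm a' b' c' s') D) :
    a = a' ∧ b = b' ∧ c = c' ∧ s = s' := by
  obtain ⟨z, hz⟩ := hne
  obtain ⟨δ, hδ, hzδ⟩ := exists_shift_mem hD hz
  have h1 := h hz
  have h2 := h hzδ
  simp only [normalForm, Prod.mk.injEq] at h1 h2
  obtain ⟨⟨h11, h12⟩, h13⟩ := h1
  obtain ⟨⟨h21, -⟩, -⟩ := h2
  have hs : s = s' := by
    refine mul_right_cancel₀ hδ.ne' ?_
    linear_combination h21 - h11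
  subst hs
  have hc : c = c' := by linear_combination (-6) * h13
  subst hc
  exact ⟨by linear_combination h11, by linear_combination h12, rfl, rfl⟩

/-- Coordinates of a map of `(x, t, u)`-space form a point symmetry. -/
theorem isPointSymmetry_of_isSymmetryOn {D : Set Total} {Φ : Total → Total} (hD : IsOpen D)
    (hΦ : IsPointTransformationOn D Φ) (hsym : IsSymmetryOn D Φ) :
    IsPointSymmetry D (fun z => (Φ z).1.1) (fun z => (Φ z).1.2) (fun z => (Φ z).2) where
  isOpen := hD
  smoothX := (contDiff_fst.comp contDiff_fst).comp_contDiffOn hΦ.1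
  smoothT := (contDiff_snd.comp contDiff_fst).comp_contDiffOn hΦ.1
  smoothU := contDiff_snd.comp_contDiffOn hΦ.1
  sym := hsym
  det := by
    intro z hz
    have hd : HasFDerivAt Φ (fderiv ℝ Φ z) z :=
      ((hΦ.1.contDiffAt (hD.mem_nhds hz)).differentiableAt (by simp)).hasFDerivAt
    have hX : ∀ e, pd e (fun z => (Φ z).1.1) z = (fderiv ℝ Φ z e).1.1 := fun e => by
      rw [pd, hd.fst.fst.fderiv]
      rfl
    have hT : ∀ e, pd e (fun z => (Φ z).1.2) z = (fderiv ℝ Φ z e).1.2 := fun e => by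
      rw [pd, hd.fst.snd.fderiv]
      rfl
    have hU : ∀ e, pd e (fun z => (Φ z).2) z = (fderiv ℝ Φ z e).2 := fun e => by
      rw [pd, hd.snd.fderiv]
      rfl
    obtain ⟨A, hA⟩ := hΦ.2 z hz
    have hr : ∀ w : Total, ∃ a : Total, pd a (fun z => (Φ z).1.1) z = w.1.1 ∧
        pd a (fun z => (Φ z).1.2) z = w.1.2 ∧ pd a (fun z => (Φ z).2) z = w.2 := fun w => by
      refine ⟨A.symm w, ?_⟩
      rw [hX, hT, hU, ← hA]
      simp
    obtain ⟨a, a1, a2, a3⟩ := hr ex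
    obtain ⟨b, b1, b2, b3⟩ := hr et
    obtain ⟨c, c1, c2, c3⟩ := hr eu
    rw [pd_eq_coordinates] at a1 a2 a3 b1 b2 b3 c1 c2 c3
    set M : Matrix (Fin 3) (Fin 3) ℝ :=
      !![pd ex (fun z => (Φ z).1.1) z, pd et (fun z => (Φ z).1.1) z, pd eu (fun z => (Φ z).1.1) z;
        pd ex (fun z => (Φ z).1.2) z, pd et (fun z => (Φ z).1.2) z, pd eu (fun z => (Φ z).1.2) z;
        pd ex (fun z => (Φ z).2) z, pd et (fun z => (Φ z).2) z, pd eu (fun z => (Φ z).2) z] with hM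
    -- The columns of `N` are the preimages of the coordinate vectors under the derivative, so `N`
    -- is a right inverse of the Jacobian matrix.
    set N : Matrix (Fin 3) (Fin 3) ℝ :=
      !![a.1.1, b.1.1, c.1.1; a.1.2, b.1.2, c.1.2; a.2, b.2, c.2] with hN
    have hMN : M * N = 1 := by
      simp only [ex, et, eu] at a1 a2 a3 b1 b2 b3 c1 c2 c3
      ext i j
      fin_cases i <;> fin_cases j <;>
        simp [hM, hN, Matrix.mul_apply, Fin.sum_univ_three, ex, et, eu] <;> linarith
    have hdet : M.det * N.det = 1 := by rw [← Matrix.det_mul, hMN, Matrix.det_one]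
    intro h0
    have : M.det = 0 := by
      rw [Matrix.det_fin_three]
      simp only [hM, Matrix.of_apply, Matrix.cons_val]
      linear_combination h0
    rw [this, zero_mul] at hdet
    exact zero_ne_one hdet

theorem exists_normalForm_of_isSymmetryOn {D : Set Total} {Φ : Total → Total} (hD : IsOpen D)
    (hc : IsConnected D) (hΦ : IsPointTransformationOn D Φ) (hsym : IsSymmetryOn D Φ) :
    ∃ a b c s : ℝ, s ≠ 0 ∧ EqOn Φ (normalForm a b c s) D :=
  (isPointSymmetry_of_isSymmetryOn hD hΦ hsym).exists_normalForm hc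

theorem isSymmetryOn_iff {D : Set Total} {Φ : Total → Total} (hD : IsOpen D)
    (hc : IsConnected D) (hΦ : IsPointTransformationOn D Φ) :
    IsSymmetryOn D Φ ↔ ∃! q : ℝ × ℝ × ℝ × ℝ, q.2.2.2 ≠ 0 ∧
      EqOn Φ (spaceTranslation q.1 ∘ timeTranslation q.2.1 ∘ galileanBoost q.2.2.1 ∘
        coupledScaling q.2.2.2) D := by
  simp only [comp_eq_normalForm]
  refine ⟨fun h => ?_, fun ⟨q, ⟨hq, he⟩, _⟩ => isSymmetryOn_of_eqOn_normalForm hq he⟩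
  obtain ⟨a, b, c, s, hs, he⟩ := exists_normalForm_of_isSymmetryOn hD hc hΦ h
  refine ⟨(a, b, c, s), ⟨hs, he⟩, ?_⟩
  rintro ⟨a', b', c', s'⟩ ⟨-, he'⟩
  obtain ⟨rfl, rfl, rfl, rfl⟩ := normalForm_injective hD hc.nonempty (he'.symm.trans he)
  rfl

/-! ### The infinitesimal generators. -/

/-- The linear combination of the four infinitesimal generators with coefficients `k`. -/
noncomputable def generatorField (k : ℝ × ℝ × ℝ × ℝ) (z : Total) : Total :=
  ((k.2.2.2 * z.1.1 - k.2.2.1 * z.1.2 + k.1, 3 * k.2.2.2 * z.1.2 + k.2.1),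
    -2 * k.2.2.2 * z.2 - k.2.2.1 / 6)

theorem hasDerivAt_normalForm {a b c s : ℝ → ℝ} {a' b' c' s' : ℝ} (ha : HasDerivAt a a' 0)
    (hb : HasDerivAt b b' 0) (hc : HasDerivAt c c' 0) (hs : HasDerivAt s s' 0) (hc0 : c 0 = 0)
    (hs0 : s 0 = 1) (z : Total) :
    HasDerivAt (fun ε => normalForm (a ε) (b ε) (c ε) (s ε) z)
      (generatorField (a', b', c', s') z) 0 := by
  have h3 := hs.fun_pow 3
  have h1 := ((hs.mul_const z.1.1).fun_sub (hc.fun_mul (h3.mul_const z.1.2))).fun_add ha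
  have h2 := (h3.mul_const z.1.2).fun_add hb
  have h4 := ((hasDerivAt_const (0 : ℝ) z.2).fun_div (hs.fun_pow 2)
    (by simp [hs0])).fun_sub (hc.div_const 6)
  refine ((h1.prodMk h2).prodMk h4).congr_deriv ?_
  simp only [generatorField, hs0, hc0]
  ext <;> norm_num <;> ring

theorem generator_spaceTranslation (z : Total) : generator spaceTranslation z = ((1, 0), 0) := by
  have h := hasDerivAt_normalForm (hasDerivAt_id 0) (hasDerivAt_const 0 0) (hasDerivAt_const 0 0)
    (hasDerivAt_const 0 1) rfl rfl z
  have e : (fun ε => spaceTranslation ε z) = fun ε => normalForm (id ε) 0 0 1 z := by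
    funext ε
    simp [normalForm, spaceTranslation]
  rw [generator, e, h.deriv]
  simp [generatorField]

theorem generator_timeTranslation (z : Total) : generator timeTranslation z = ((0, 1), 0) := by
  have h := hasDerivAt_normalForm (hasDerivAt_const 0 0) (hasDerivAt_id 0) (hasDerivAt_const 0 0)
    (hasDerivAt_const 0 1) rfl rfl z
  have e : (fun ε => timeTranslation ε z) = fun ε => normalForm 0 (id ε) 0 1 z := by
    funext ε
    simp [normalForm, timeTranslation]
  rw [generator, e, h.deriv]
  simp [generatorField]

theorem generator_galileanBoost (z : Total) :
    generator galileanBoost z = ((-z.1.2, 0), -1 / 6) := by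
  have h := hasDerivAt_normalForm (hasDerivAt_const 0 0) (hasDerivAt_const 0 0) (hasDerivAt_id 0)
    (hasDerivAt_const 0 1) rfl rfl z
  have e : (fun ε => galileanBoost ε z) = fun ε => normalForm 0 0 (id ε) 1 z := by
    funext ε
    simp [normalForm, galileanBoost]
  rw [generator, e, h.deriv]
  simp [generatorField, neg_div]

theorem generator_coupledScaling (z : Total) :
    generator (fun ε => coupledScaling (Real.exp ε)) z = ((z.1.1, 3 * z.1.2), -2 * z.2) := by
  have h := hasDerivAt_normalForm (hasDerivAt_const 0 0) (hasDerivAt_const 0 0)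
    (hasDerivAt_const 0 0) (Real.hasDerivAt_exp 0) rfl Real.exp_zero z
  have e : (fun ε => coupledScaling (Real.exp ε) z)
      = fun ε => normalForm 0 0 0 (Real.exp ε) z := by
    funext ε
    simp [normalForm, coupledScaling]
  rw [generator, e, h.deriv]
  simp [generatorField]

theorem smul_generators_eq (k : ℝ × ℝ × ℝ × ℝ) (z : Total) :
    k.1 • generator spaceTranslation z + k.2.1 • generator timeTranslation z
      + k.2.2.1 • generator galileanBoost z
      + k.2.2.2 • generator (fun ε => coupledScaling (Real.exp ε)) z = generatorField k z := by
  rw [generator_spaceTranslation, generator_timeTranslation, generator_galileanBoost,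
    generator_coupledScaling]
  ext <;> simp [generatorField] <;> ring

theorem generatorField_injective {D : Set Total} (hD : IsOpen D) (hne : D.Nonempty)
    {k k' : ℝ × ℝ × ℝ × ℝ} (h : EqOn (generatorField k) (generatorField k') D) : k = k' := by
  obtain ⟨z, hz⟩ := hne
  obtain ⟨δ, hδ, hzδ⟩ := exists_shift_mem hD hz
  have h1 := h hz
  have h2 := h hzδ
  obtain ⟨k1, k2, k3, k4⟩ := k
  obtain ⟨l1, l2, l3, l4⟩ := k'
  simp only [generatorField, Prod.mk.injEq] at h1 h2
  obtain ⟨⟨h11, h12⟩, h13⟩ := h1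
  obtain ⟨⟨h21, -⟩, -⟩ := h2
  have e4 : k4 = l4 := by
    refine mul_right_cancel₀ hδ.ne' ?_
    linear_combination h21 - h11
  subst e4
  have e3 : k3 = l3 := by linear_combination (-6) * h13
  subst e3
  have e2 : k2 = l2 := by linear_combination h12
  have e1 : k1 = l1 := by linear_combination h11
  rw [e1, e2]

theorem normalForm_contDiff {a b c s : ℝ → ℝ} {n : WithTop ℕ∞} (ha : ContDiff ℝ n a)
    (hb : ContDiff ℝ n b) (hc : ContDiff ℝ n c) (hs : ContDiff ℝ n s) (hs0 : ∀ ε, s ε ≠ 0) :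
    ContDiff ℝ n fun w : ℝ × Total => normalForm (a w.1) (b w.1) (c w.1) (s w.1) w.2 := by
  have ha' : ContDiff ℝ n fun w : ℝ × Total => a w.1 := ha.comp contDiff_fst
  have hb' : ContDiff ℝ n fun w : ℝ × Total => b w.1 := hb.comp contDiff_fst
  have hc' : ContDiff ℝ n fun w : ℝ × Total => c w.1 := hc.comp contDiff_fst
  have hs' : ContDiff ℝ n fun w : ℝ × Total => s w.1 := hs.comp contDiff_fst
  have hx : ContDiff ℝ n fun w : ℝ × Total => w.2.1.1 := by fun_prop
  have ht : ContDiff ℝ n fun w : ℝ × Total => w.2.1.2 := by fun_prop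
  have hu : ContDiff ℝ n fun w : ℝ × Total => w.2.2 := by fun_prop
  exact ((((hs'.mul hx).sub (hc'.mul ((hs'.pow 3).mul ht))).add ha').prodMk
    (((hs'.pow 3).mul ht).add hb')).prodMk
    ((hu.div (hs'.pow 2) fun w => pow_ne_zero 2 (hs0 _)).sub (hc'.div_const 6))

/-! ### Every linear combination of generators integrates to symmetries. -/

/-- A global one-parameter group of normal forms restricts to a local one-parameter group of
symmetries of any open set. -/
theorem isInfinitesimalSymmetryOn_of_flow {M : Set Total} (hM : IsOpen M) {a b c s : ℝ → ℝ}
    (ha : ContDiff ℝ ∞ a) (hb : ContDiff ℝ ∞ b) (hc : ContDiff ℝ ∞ c) (hs : ContDiff ℝ ∞ s)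
    (hs0 : ∀ ε, s ε ≠ 0) (a0 : a 0 = 0) (b0 : b 0 = 0) (c0 : c 0 = 0) (s0 : s 0 = 1)
    (hadd : ∀ ε δ z, normalForm (a ε) (b ε) (c ε) (s ε) (normalForm (a δ) (b δ) (c δ) (s δ) z)
      = normalForm (a (ε + δ)) (b (ε + δ)) (c (ε + δ)) (s (ε + δ)) z) {k : ℝ × ℝ × ℝ × ℝ}
    (dera : HasDerivAt a k.1 0) (derb : HasDerivAt b k.2.1 0) (derc : HasDerivAt c k.2.2.1 0)
    (ders : HasDerivAt s k.2.2.2 0) : IsInfinitesimalSymmetryOn M (generatorField k) := by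
  set Ψ : ℝ × Total → Total := fun w => normalForm (a w.1) (b w.1) (c w.1) (s w.1) w.2 with hΨ
  have hsm : ContDiff ℝ ∞ Ψ := normalForm_contDiff ha hb hc hs hs0
  have hzero : ∀ z, Ψ (0, z) = z := fun z => by simp [hΨ, normalForm, a0, b0, c0, s0]
  have hcomp : ∀ ε δ z, Ψ (ε, Ψ (δ, z)) = Ψ (ε + δ, z) := hadd
  have hinv : ∀ ε z, Ψ (-ε, Ψ (ε, z)) = z := fun ε z => by
    rw [hcomp, neg_add_cancel, hzero]
  refine ⟨{w | w.2 ∈ M ∧ Ψ w ∈ M}, Ψ, ⟨(hM.preimage continuous_snd).inter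
    (hM.preimage hsm.continuous), fun w hw => hw.1, fun z hz => ⟨hz, by rwa [hzero]⟩,
    fun w hw => hw.2, hsm.contDiffOn, fun z _ => hzero z, fun ε δ z _ _ _ => hcomp ε δ z,
    fun ε z hw => ⟨hw.2, by rw [hinv]; exact hw.1⟩, fun ε z _ => hinv ε z⟩, fun ε => ?_,
    fun z _ => ?_⟩
  · exact isSymmetryOn_of_eqOn_normalForm (a := a ε) (b := b ε) (c := c ε) (hs0 ε) fun z _ => rfl
  · exact hasDerivAt_normalForm dera derb derc ders c0 s0 z

theorem isInfinitesimalSymmetryOn_generatorField {M : Set Total} (hM : IsOpen M)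
    (k : ℝ × ℝ × ℝ × ℝ) : IsInfinitesimalSymmetryOn M (generatorField k) := by
  obtain ⟨α, β, γ, κ⟩ := k
  by_cases hκ : κ = 0
  · subst hκ
    have hid := hasDerivAt_id (0 : ℝ)
    -- Boosts and time translations do not commute; the quadratic term of `a` absorbs the cross term
    -- `-γ β ε δ` of the composition.
    refine isInfinitesimalSymmetryOn_of_flow (a := fun ε => α * ε - γ * β / 2 * ε ^ 2)
      (b := fun ε => β * ε) (c := fun ε => γ * ε) (s := fun _ => 1) hM (by fun_prop) (by fun_prop)
      (by fun_prop) (by fun_prop) (fun _ => one_ne_zero) (by simp) (by simp) (by simp) rfl ?_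
      ?_ ?_ ?_ (hasDerivAt_const _ _)
    · intro ε δ z
      simp only [normalForm]
      ext <;> simp only <;> ring
    · simpa using (hid.const_mul α).fun_sub ((hid.fun_pow 2).const_mul (γ * β / 2))
    · simpa using hid.const_mul β
    · simpa using hid.const_mul γ
  -- For `κ ≠ 0` the field vanishes at the point `(x₀, t₀, -m / 6)`. The flow is the scaling group
  -- conjugated to fix that point and to carry the shear belonging to `γ`.
  · set t₀ := -β / (3 * κ) with ht₀
    set x₀ := (γ * t₀ - α) / κ with hx₀
    set m := γ / (2 * κ) with hm
    have hexp : ContDiff ℝ ∞ fun ε : ℝ => Real.exp (κ * ε) := by fun_prop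
    have hpos : ∀ ε : ℝ, Real.exp (κ * ε) ≠ 0 := fun ε => (Real.exp_pos _).ne'
    have hder : HasDerivAt (fun ε : ℝ => Real.exp (κ * ε)) κ 0 := by
      simpa using ((hasDerivAt_id (0 : ℝ)).const_mul κ).exp
    refine isInfinitesimalSymmetryOn_of_flow
      (a := fun ε => x₀ * (1 - Real.exp (κ * ε))
        + m * t₀ * (Real.exp (κ * ε) ^ 3 - Real.exp (κ * ε)))
      (b := fun ε => t₀ * (1 - Real.exp (κ * ε) ^ 3))
      (c := fun ε => m * (1 - 1 / Real.exp (κ * ε) ^ 2)) (s := fun ε => Real.exp (κ * ε)) hM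
      (by fun_prop) (by fun_prop) ?_ hexp hpos (by simp) (by simp) (by simp) (by simp) ?_
      ?_ ?_ ?_ hder
    · exact contDiff_const.mul (contDiff_const.sub
        (contDiff_const.div (hexp.pow 2) fun ε => pow_ne_zero 2 (hpos ε)))
    · intro ε δ z
      have e : Real.exp (κ * (ε + δ)) = Real.exp (κ * ε) * Real.exp (κ * δ) := by
        rw [mul_add, Real.exp_add]
      have h1 := hpos ε
      have h2 := hpos δ
      simp only [normalForm, e]
      generalize Real.exp (κ * ε) = σ at *
      generalize Real.exp (κ * δ) = τ at *
      ext <;> simp only <;> field_simp <;> ring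
    · have := ((hder.const_sub 1).const_mul x₀).fun_add
        (((hder.fun_pow 3).fun_sub hder).const_mul (m * t₀))
      refine this.congr_deriv ?_
      simp only [mul_zero, Real.exp_zero, hx₀, hm]
      field_simp
      norm_num
      ring
    · have := ((hder.fun_pow 3).const_sub 1).const_mul t₀
      refine this.congr_deriv ?_
      simp only [mul_zero, Real.exp_zero, ht₀]
      field_simp
      norm_num
    · have := (((hasDerivAt_const (0 : ℝ) (1 : ℝ)).fun_div (hder.fun_pow 2)
        (pow_ne_zero 2 (hpos 0))).const_sub 1).const_mul m
      refine this.congr_deriv ?_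
      simp only [mul_zero, Real.exp_zero, hm]
      field_simp
      norm_num
      ring

/-! ### Every infinitesimal symmetry is a combination of the four generators. -/

/-- Differentiating `Ψ (-ε, Ψ (ε, z)) = z` gives the derivative a left inverse, and in finite
dimension it is then invertible. -/
theorem IsLocalOneParameterGroup.isPointTransformationOn {M : Set Total} {W : Set (ℝ × Total)}
    {Ψ : ℝ × Total → Total} (h : IsLocalOneParameterGroup M W Ψ) (ε : ℝ) :
    IsPointTransformationOn {z | (ε, z) ∈ W} fun z => Ψ (ε, z) := by
  have hslice : ∀ ε : ℝ, ContDiff ℝ ∞ fun z : Total => (ε, z) := fun ε => by fun_prop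
  have ho : ∀ ε : ℝ, IsOpen {z | (ε, z) ∈ W} := fun ε =>
    h.isOpen.preimage (hslice ε).continuous
  have hsm : ∀ ε : ℝ, ContDiffOn ℝ ∞ (fun z => Ψ (ε, z)) {z | (ε, z) ∈ W} := fun ε =>
    h.smooth.comp (hslice ε).contDiffOn fun _ hz => hz
  have hd : ∀ ε z, (ε, z) ∈ W → DifferentiableAt ℝ (fun z => Ψ (ε, z)) z := fun ε z hz =>
    ((hsm ε).contDiffAt ((ho ε).mem_nhds hz)).differentiableAt (by simp)
  refine ⟨hsm ε, fun z hz => ?_⟩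
  set A := fderiv ℝ (fun z => Ψ (ε, z)) z with hA
  have hcomp := (hd (-ε) _ (h.inv_mem ε z hz)).hasFDerivAt.comp z (hd ε z hz).hasFDerivAt
  have hid : HasFDerivAt ((fun z => Ψ (-ε, z)) ∘ fun z => Ψ (ε, z))
      (ContinuousLinearMap.id ℝ Total) z := by
    refine (hasFDerivAt_id z).congr_of_eventuallyEq ?_
    filter_upwards [(ho ε).mem_nhds hz] with w hw
    exact h.inv_apply ε w hw
  have hinj : Function.Injective (A : Total →ₗ[ℝ] Total) := by
    refine Function.LeftInverse.injective
      (g := fderiv ℝ (fun z => Ψ (-ε, z)) (Ψ (ε, z))) fun v => ?_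
    exact congrArg (fun L : Total →L[ℝ] Total => L v) (hcomp.unique hid)
  exact ⟨(LinearEquiv.ofInjectiveEndo (A : Total →ₗ[ℝ] Total) hinj).toContinuousLinearEquiv,
    ContinuousLinearMap.ext fun _ => rfl⟩

theorem IsInfinitesimalSymmetryOn.exists_local {M : Set Total} {V : Total → Total}
    (h : IsInfinitesimalSymmetryOn M V) {z₀ : Total} (hz₀ : z₀ ∈ M) :
    ∃ k, ∃ B : Set Total, IsOpen B ∧ z₀ ∈ B ∧ EqOn V (generatorField k) B := by
  obtain ⟨W, Ψ, hΨ, hsym, hV⟩ := h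
  -- A product of balls inside `W` gives one connected domain `B` on which all elements with small
  -- `ε` are defined and classified.
  obtain ⟨r, hr, hball⟩ := Metric.isOpen_iff.1 hΨ.isOpen _ (hΨ.zero_mem z₀ hz₀)
  set B := Metric.ball z₀ r with hB
  have hBW : ∀ ε ∈ Metric.ball (0 : ℝ) r, B ⊆ {z | (ε, z) ∈ W} := fun ε hε z hz =>
    hball (by rw [← ball_prod_same]; exact ⟨hε, hz⟩)
  have h0r : (0 : ℝ) ∈ Metric.ball (0 : ℝ) r := Metric.mem_ball_self hr
  have hBM : B ⊆ M := fun z hz => hΨ.mem_base _ (hBW 0 h0r hz)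
  have hz₀B : z₀ ∈ B := Metric.mem_ball_self hr
  have hBo : IsOpen B := Metric.isOpen_ball
  have hBc : IsConnected B := Metric.isConnected_ball hr
  have hnf : ∀ ε, ε ∈ Metric.ball (0 : ℝ) r →
      ∃ a b c s : ℝ, s ≠ 0 ∧ EqOn (fun z => Ψ (ε, z)) (normalForm a b c s) B := fun ε hε => by
    have hpt := hΨ.isPointTransformationOn ε
    exact exists_normalForm_of_isSymmetryOn hBo hBc
      ⟨hpt.1.mono (hBW ε hε), fun z hz => hpt.2 z (hBW ε hε hz)⟩
      fun Ω Ω' u v h1 h2 h3 h4 => hsym ε Ω Ω' u v h1 h2 h3 (h4.trans (hBW ε hε))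
  choose! a b c s hs0 he using hnf
  have hev : ∀ᶠ ε in 𝓝 (0 : ℝ), ε ∈ Metric.ball (0 : ℝ) r :=
    Metric.isOpen_ball.mem_nhds h0r
  obtain ⟨-, -, c0, s0⟩ : a 0 = 0 ∧ b 0 = 0 ∧ c 0 = 0 ∧ s 0 = 1 :=
    normalForm_injective hBo ⟨z₀, hz₀B⟩ fun z hz => by
      rw [← he 0 h0r hz]
      simp only [hΨ.zero_apply z (hBM hz)]
      simp [normalForm]
  -- The orbits of `z₀` and of a point shifted in `x` are differentiable at `0`. The parameters,
  -- recovered from them in the order `s`, `c`, `b`, `a`, inherit this, although they were merely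
  -- chosen for each `ε`.
  obtain ⟨δ, hδ, hzδ⟩ := exists_shift_mem hBo hz₀B
  have hd := (hV z₀ hz₀).differentiableAt
  have hd' := (hV _ (hBM hzδ)).differentiableAt
  have ds : DifferentiableAt ℝ s 0 := by
    refine ((hd'.fst.fst.fun_sub hd.fst.fst).div_const δ).congr_of_eventuallyEq ?_
    filter_upwards [hev] with ε hε
    have e1 := he ε hε hz₀B
    have e2 := he ε hε hzδ
    simp only at e1 e2
    simp only [e1, e2, normalForm]
    field_simp
    ring
  have dc : DifferentiableAt ℝ c 0 := by
    have hq : DifferentiableAt ℝ (fun ε => z₀.2 / s ε ^ 2) 0 :=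
      (differentiableAt_const _).fun_div (ds.fun_pow 2) (by simp [s0])
    refine ((hq.fun_sub hd.snd).const_mul 6).congr_of_eventuallyEq ?_
    filter_upwards [hev] with ε hε
    have e1 := he ε hε hz₀B
    simp only at e1
    simp only [e1, normalForm]
    ring
  have db : DifferentiableAt ℝ b 0 := by
    refine (hd.fst.snd.fun_sub
      ((ds.fun_pow 3).mul_const z₀.1.2)).congr_of_eventuallyEq ?_
    filter_upwards [hev] with ε hε
    have e1 := he ε hε hz₀B
    simp only at e1
    simp only [e1, normalForm]
    ring
  have da : DifferentiableAt ℝ a 0 := by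
    refine (hd.fst.fst.fun_sub ((ds.mul_const z₀.1.1).fun_sub
      (dc.fun_mul ((ds.fun_pow 3).mul_const z₀.1.2)))).congr_of_eventuallyEq ?_
    filter_upwards [hev] with ε hε
    have e1 := he ε hε hz₀B
    simp only at e1
    simp only [e1, normalForm]
    ring
  refine ⟨(deriv a 0, deriv b 0, deriv c 0, deriv s 0), B, hBo, hz₀B, fun z hz => ?_⟩
  refine (hV z (hBM hz)).unique ((hasDerivAt_normalForm da.hasDerivAt db.hasDerivAt dc.hasDerivAt
    ds.hasDerivAt c0 s0 z).congr_of_eventuallyEq ?_)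
  filter_upwards [hev] with ε hε
  exact he ε hε hz

/-- On overlaps of the local balls the coefficients agree by `generatorField_injective`, so they are
locally constant on the connected set `M`. -/
theorem IsInfinitesimalSymmetryOn.exists_generatorField {M : Set Total} {V : Total → Total}
    (hc : IsConnected M) (h : IsInfinitesimalSymmetryOn M V) :
    ∃ k, EqOn V (generatorField k) M := by
  have hloc : ∀ z : M, ∃ k, ∃ B : Set Total, IsOpen B ∧ (z : Total) ∈ B ∧
      EqOn V (generatorField k) B := fun z => h.exists_local z.2
  choose k B hBo hzB hk using hloc
  have hlc : IsLocallyConstant k := by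
    rw [IsLocallyConstant.iff_eventually_eq]
    intro z
    filter_upwards [((hBo z).preimage continuous_subtype_val).mem_nhds (hzB z)] with w hw
    exact generatorField_injective ((hBo w).inter (hBo z)) ⟨w, hzB w, hw⟩
      fun y hy => (hk w hy.1).symm.trans (hk z hy.2)
  have : PreconnectedSpace M := isPreconnected_iff_preconnectedSpace.1 hc.isPreconnected
  obtain ⟨z₀, hz₀⟩ := hc.nonempty
  refine ⟨k ⟨z₀, hz₀⟩, fun z hz => ?_⟩
  rw [hlc.apply_eq_of_preconnectedSpace ⟨z₀, hz₀⟩ ⟨z, hz⟩]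
  exact hk ⟨z, hz⟩ (hzB ⟨z, hz⟩)

theorem IsInfinitesimalSymmetryOn.congr {M : Set Total} {V V' : Total → Total}
    (h : IsInfinitesimalSymmetryOn M V) (hV : EqOn V' V M) : IsInfinitesimalSymmetryOn M V' := by
  obtain ⟨W, Ψ, h1, h2, h3⟩ := h
  exact ⟨W, Ψ, h1, h2, fun z hz => by rw [hV hz]; exact h3 z hz⟩

theorem isInfinitesimalSymmetryOn_iff {M : Set Total} {V : Total → Total} (hM : IsOpen M)
    (hc : IsConnected M) :
    IsInfinitesimalSymmetryOn M V ↔ ∃! k : ℝ × ℝ × ℝ × ℝ, ∀ z ∈ M,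
      V z = k.1 • generator spaceTranslation z + k.2.1 • generator timeTranslation z
        + k.2.2.1 • generator galileanBoost z
        + k.2.2.2 • generator (fun ε => coupledScaling (Real.exp ε)) z := by
  simp only [smul_generators_eq]
  refine ⟨fun h => ?_, fun ⟨k, hk, _⟩ => (isInfinitesimalSymmetryOn_generatorField hM k).congr hk⟩
  obtain ⟨k, hk⟩ := h.exists_generatorField hc
  exact ⟨k, hk, fun k' hk' => generatorField_injective hM hc.nonempty
    fun z hz => (hk' z hz).symm.trans (hk hz)⟩

end KdV

theorem mainTheorem5 :
    -- the four transformations turn solutions on the plane into solutions, and conversely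
    ((∀ (u : ℝ × ℝ → ℝ) (a : ℝ),
        KdV.IsSolution u ↔ KdV.IsSolution (fun p => u (p.1 + a, p.2))) ∧
      (∀ (u : ℝ × ℝ → ℝ) (b : ℝ),
        KdV.IsSolution u ↔ KdV.IsSolution (fun p => u (p.1, p.2 + b))) ∧
      (∀ (u : ℝ × ℝ → ℝ) (s : ℝ), s ≠ 0 →
        (KdV.IsSolution u ↔
          KdV.IsSolution (fun p => 1 / s ^ 2 * u (1 / s * p.1, 1 / s ^ 3 * p.2)))) ∧
      (∀ (u : ℝ × ℝ → ℝ) (c : ℝ),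
        KdV.IsSolution u ↔ KdV.IsSolution (fun p => u (p.1 + c * p.2, p.2) - c / 6))) ∧
    -- a point transformation is a symmetry iff it is a composition of these four,
    -- and the four parameters are then unique
    (∀ (D : Set KdV.Total) (Φ : KdV.Total → KdV.Total), IsOpen D → IsConnected D →
      KdV.IsPointTransformationOn D Φ →
      (KdV.IsSymmetryOn D Φ ↔
        ∃! q : ℝ × ℝ × ℝ × ℝ, q.2.2.2 ≠ 0 ∧
          Set.EqOn Φ (KdV.spaceTranslation q.1 ∘ KdV.timeTranslation q.2.1 ∘
            KdV.galileanBoost q.2.2.1 ∘ KdV.coupledScaling q.2.2.2) D)) ∧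
    -- the infinitesimal symmetries are the linear combinations of the four generators,
    -- with unique coefficients
    (∀ (M : Set KdV.Total) (V : KdV.Total → KdV.Total), IsOpen M → IsConnected M →
      (KdV.IsInfinitesimalSymmetryOn M V ↔
        ∃! k : ℝ × ℝ × ℝ × ℝ, ∀ z ∈ M,
          V z = k.1 • KdV.generator KdV.spaceTranslation z
            + k.2.1 • KdV.generator KdV.timeTranslation z
            + k.2.2.1 • KdV.generator KdV.galileanBoost z
            + k.2.2.2 • KdV.generator (fun ε => KdV.coupledScaling (Real.exp ε)) z)) := by
  refine ⟨⟨KdV.isSolution_translate_space_iff, KdV.isSolution_translate_time_iff,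
    fun u s hs => KdV.isSolution_scale_iff u hs, KdV.isSolution_boost_iff⟩,
    fun D Φ hD hc hΦ => KdV.isSymmetryOn_iff hD hc hΦ,
    fun M V hM hc => KdV.isInfinitesimalSymmetryOn_iff hM hc⟩
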